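/- Let $\mathfrak C$ be the octonions with basis $e_0=1,e_1,\dots,e_7$, $e_i^2=-1$, $e_ie_{i+1}=e_{i+3}$ for $i\ge 1$ (indices mod $7$, each triple $e_i,e_{i+1},e_{i+3}$ multiplying like the imaginary quaternion units), with conjugation $x\mapsto\bar x$, norm $N(x)=\sum x_i^2$, trace $\mathrm{Tr}(x)=2x_0$, and let $\mathfrak o$ be the integral octonions, the lattice with $\mathbb Z$-basis $e_0$, $e_1$, $e_2$, $-e_4$, $\tfrac12(e_1+e_2+e_3+e_4)$, $\tfrac12(-e_0-e_1-e_4+e_5)$, $\tfrac12(-e_0+e_1-e_2+e_6)$, $\tfrac12(-e_0+e_2+e_4+e_7)$. For $R=\mathbb R,\mathbb C$ let $\mathfrak J(R)$ be the exceptional Jordan algebra of matrices $$X=\begin{pmatrix}a&x&y\\ \bar x&b&z\\ \bar y&\bar z&c\end{pmatrix},\qquad a,b,c\in R,\ x,y,z\in\mathfrak C\otimes R,$$ with $X\circ Y=\frac12(XY+YX)$, $(X,Y)=\mathrm{Tr}(X\circ Y)$, $\det X=abc-aN(z)-bN(y)-cN(x)+\mathrm{Tr}((xz)\bar y)$ and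 adjugate $$X\times X=\begin{pmatrix} bc-N(z)&y\bar z-cx&xz-by\\ z\bar y-c\bar x&ac-N(y)&\bar xy-az\\ \bar z\bar x-b\bar y&\bar yx-a\bar z&ab-N(x)\end{pmatrix}.$$ Let $\mathfrak J(\mathbb Z)\subset\mathfrak J(\mathbb R)$ be the lattice of elements with $a,b,c\in\mathbb Z$ and $x,y,z\in\mathfrak o$. Let $R_3^+=\{X^2: X\in\mathfrak J(\mathbb R),\det X\ne0\}$ and $\mathfrak T=\{X+iY: X,Y\in\mathfrak J(\mathbb R),\ Y\in R_3^+\}\subset\mathfrak J(\mathbb C)$, the exceptional tube domain. Let $E_{7,3}(\mathbb R)$ be the group of linear automorphisms of $W=\mathfrak J(\mathbb R)\oplus\mathbb R\oplus\mathfrak J(\mathbb R)\oplus\mathbb R$ (elements $(X,\xi,X',\xi')$) preserving the quartic form $(X\times X,X'\times X')-\xi\det X-\xi'\det X'-\frac14((X,X')-\xi\xi')^2$ and the alternating form $(X_1,X_2')-(X_2,X_1')+\xi_1\xi_2'-\xi_2\xi_1'$, and let $E_{7,3}(\mathbb Z)$ be the stabilizer in it of the lattice $\mathfrak J(\mathbb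 Z)\oplus\mathbb Z\oplus\mathfrak J(\mathbb Z)\oplus\mathbb Z$. The action on $\mathfrak T$ and the factor of automorphy $j$ are given by $$\gamma\,(Z,\det Z,Z\times Z,1)=j(\gamma,Z)\,(\gamma Z,\det \gamma Z,\gamma Z\times\gamma Z,1)$$ in $W\otimes\mathbb C$. For a subgroup $\Gamma'$ of $E_{7,3}(\mathbb R)$ commensurable with $E_{7,3}(\mathbb Z)$ and $k\in\mathbb Z$, a modular form of weight $k$ for $\Gamma'$ is a holomorphic function $F$ on $\mathfrak T$ with $F(\gamma Z)=j(\gamma,Z)^kF(Z)$ for all $\gamma\in\Gamma'$, $Z\in\mathfrak T$. It has level one if $\Gamma'=E_{7,3}(\mathbb Z)$. A level-one form $F$ is a cusp form if $$\Phi(F)(Z')=\lim_{\mathrm{Im}\,\tau\to\infty}F\begin{pmatrix}Z'&0\\0&\tau\end{pmatrix}=0$$ for all $Z'$ in the analogous tube domain of $2\times2$ Hermitian octonionic matrices (imaginary part a square of an element of nonzero determinant). Let $\mathbb H_n$ be the Siegel upper half space of degree $n$. For a subgroup $\Delta$ of $Sp_6(\mathbb R)$ commensurable with $Sp_6(\mathbb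 Z)$, a Siegel modular form of weight $k$ for $\Delta$ is a holomorphic function $f$ on $\mathbb H_3$ with $f((AZ+B)(CZ+D)^{-1})=\det(CZ+D)^kf(Z)$ for all $\begin{pmatrix}A&B\\C&D\end{pmatrix}\in\Delta$, $Z\in\mathbb H_3$. It has level one if $\Delta=Sp_6(\mathbb Z)$, and a level-one form is a cusp form if $\lim_{\mathrm{Im}\,\tau\to\infty}f\begin{pmatrix}Z'&0\\0&\tau\end{pmatrix}=0$ for all $Z'\in\mathbb H_2$. For a function $F$ on $\mathfrak T$ let $F|_{Sp_6}$ be its restriction to $\mathbb H_3$, embedded in $\mathfrak T$ as the symmetric matrices with scalar entries (in $\mathbb C e_0$ off the diagonal). Then for every $k\in\mathbb Z$: 1. If $F$ is a modular form of weight $k$ for some subgroup of $E_{7,3}(\mathbb R)$ commensurable with $E_{7,3}(\mathbb Z)$, then $F|_{Sp_6}$ is a Siegel modular form of weight $k$ for some subgroup of $Sp_6(\mathbb R)$ commensurable with $Sp_6(\mathbb Z)$. 2. If $F$ is a modular form of weight $k$ and level one, then $F|_{Sp_6}$ is a Siegel modular form of weight $k$ and level one. 3. If $F$ is a cusp form of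 weight $k$ and level one, then $F|_{Sp_6}$ is a Siegel cusp form of weight $k$ and level one. -/

import Mathlib

namespace E7

/-! ### Octonions (Cayley numbers) -/

/-- The octonions over `R`, written in the basis `e_0, …, e_7`. The product is `Oct.mul`
(not the coordinatewise product of functions). -/
abbrev Oct (R : Type*) : Type _ := Fin 8 → R

namespace Oct

/-- The octonion product: `e_0` is the unit, `e_i ^ 2 = - e_0` and `e_i e_{i+1} = e_{i+3}` for
`1 ≤ i ≤ 7` with indices modulo `7`, each triple `e_i, e_{i+1}, e_{i+3}` multiplying like the
imaginary quaternion units. -/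
def mul {R : Type*} [CommRing R] (x y : Oct R) : Oct R :=
  ![x 0 * y 0 - x 1 * y 1 - x 2 * y 2 - x 3 * y 3 - x 4 * y 4 - x 5 * y 5 - x 6 * y 6 - x 7 * y 7,
    x 0 * y 1 + x 1 * y 0 + x 2 * y 4 + x 3 * y 7 - x 4 * y 2 + x 5 * y 6 - x 6 * y 5 - x 7 * y 3,
    x 0 * y 2 - x 1 * y 4 + x 2 * y 0 + x 3 * y 5 + x 4 * y 1 - x 5 * y 3 + x 6 * y 7 - x 7 * y 6,
    x 0 * y 3 - x 1 * y 7 - x 2 * y 5 + x 3 * y 0 + x 4 * y 6 + x 5 * y 2 - x 6 * y 4 + x 7 * y 1,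
    x 0 * y 4 + x 1 * y 2 - x 2 * y 1 - x 3 * y 6 + x 4 * y 0 + x 5 * y 7 + x 6 * y 3 - x 7 * y 5,
    x 0 * y 5 - x 1 * y 6 + x 2 * y 3 - x 3 * y 2 - x 4 * y 7 + x 5 * y 0 + x 6 * y 1 + x 7 * y 4,
    x 0 * y 6 + x 1 * y 5 - x 2 * y 7 + x 3 * y 4 - x 4 * y 3 - x 5 * y 1 + x 6 * y 0 + x 7 * y 2,
    x 0 * y 7 + x 1 * y 3 + x 2 * y 6 - x 3 * y 1 + x 4 * y 5 - x 5 * y 4 - x 6 * y 2 + x 7 * y 0]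

/-- Octonion conjugation (over `ℂ` it is `ℂ`-linear). -/
def conj {R : Type*} [CommRing R] (x : Oct R) : Oct R :=
  ![x 0, -x 1, -x 2, -x 3, -x 4, -x 5, -x 6, -x 7]

/-- The norm `N(x) = ∑ x_i ^ 2`. -/
def normSq {R : Type*} [CommRing R] (x : Oct R) : R := ∑ i, x i ^ 2

/-- The trace `Tr(x) = 2 x_0`. -/
def tr {R : Type*} [CommRing R] (x : Oct R) : R := 2 * x 0

/-- The scalar octonion `r e_0`. -/
def scalar {R : Type*} [CommRing R] (r : R) : Oct R := ![r, 0, 0, 0, 0, 0, 0, 0]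

/-- The standard basis of the integral octonions. -/
noncomputable def intBasis : Fin 8 → Oct ℝ :=
  ![![1, 0, 0, 0, 0, 0, 0, 0],
    ![0, 1, 0, 0, 0, 0, 0, 0],
    ![0, 0, 1, 0, 0, 0, 0, 0],
    ![0, 0, 0, 0, -1, 0, 0, 0],
    ![0, 1 / 2, 1 / 2, 1 / 2, 1 / 2, 0, 0, 0],
    ![-1 / 2, -1 / 2, 0, 0, -1 / 2, 1 / 2, 0, 0],
    ![-1 / 2, 1 / 2, -1 / 2, 0, 0, 0, 1 / 2, 0],
    ![-1 / 2, 0, 1 / 2, 0, 1 / 2, 0, 0, 1 / 2]]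

/-- The integral octonions (integral Cayley numbers), as a lattice in the real octonions. -/
noncomputable def integral : AddSubgroup (Oct ℝ) := AddSubgroup.closure (Set.range intBasis)

end Oct

/-! ### The exceptional Jordan algebra -/

/-- The exceptional Jordan algebra: `(![a, b, c], ![x, y, z])` is the Hermitian matrix
`(a, x, y; conj x, b, z; conj y, conj z, c)`. -/
abbrev Albert (R : Type*) : Type _ := (Fin 3 → R) × (Fin 3 → Oct R)

namespace Albert

/-- The matrix square `X · X`, which is the Jordan square of `X`. -/
def sq {R : Type*} [CommRing R] (X : Albert R) : Albert R :=
  let a := X.1 0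
  let b := X.1 1
  let c := X.1 2
  let x := X.2 0
  let y := X.2 1
  let z := X.2 2
  (![a ^ 2 + Oct.normSq x + Oct.normSq y, Oct.normSq x + b ^ 2 + Oct.normSq z,
      Oct.normSq y + Oct.normSq z + c ^ 2],
   ![(a + b) • x + Oct.mul y (Oct.conj z), (a + c) • y + Oct.mul x z,
      (b + c) • z + Oct.mul (Oct.conj x) y])

/-- The quadratic map `X × X` (the adjugate of `X`). -/
def sharp {R : Type*} [CommRing R] (X : Albert R) : Albert R :=
  let a := X.1 0
  let b := X.1 1
  let c := X.1 2
  let x := X.2 0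
  let y := X.2 1
  let z := X.2 2
  (![b * c - Oct.normSq z, a * c - Oct.normSq y, a * b - Oct.normSq x],
   ![Oct.mul y (Oct.conj z) - c • x, Oct.mul x z - b • y, Oct.mul (Oct.conj x) y - a • z])

/-- The cubic determinant. -/
def det {R : Type*} [CommRing R] (X : Albert R) : R :=
  let a := X.1 0
  let b := X.1 1
  let c := X.1 2
  let x := X.2 0
  let y := X.2 1
  let z := X.2 2
  a * b * c - a * Oct.normSq z - b * Oct.normSq y - c * Oct.normSq x
    + Oct.tr (Oct.mul (Oct.mul x z) (Oct.conj y))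

/-- The trace form `(X, Y) = Tr(X ∘ Y)`, where `X ∘ Y = (X · Y + Y · X) / 2`. -/
def inner {R : Type*} [CommRing R] (X Y : Albert R) : R :=
  ∑ i, X.1 i * Y.1 i + ∑ i, Oct.tr (Oct.mul (X.2 i) (Oct.conj (Y.2 i)))

/-- Apply a map to all the coordinates. -/
def map {R S : Type*} (f : R → S) (X : Albert R) : Albert S :=
  (fun i => f (X.1 i), fun i j => f (X.2 i j))

/-- The lattice of integral elements: integral diagonal entries, and off-diagonal entries in the
ring of integral octonions. -/
def IsIntegral (X : Albert ℝ) : Prop :=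
  (∀ i, ∃ n : ℤ, X.1 i = n) ∧ ∀ i, X.2 i ∈ Oct.integral

/-- The open cone of positive elements: the squares of the elements of nonzero determinant. -/
def posCone : Set (Albert ℝ) := {Y | ∃ X : Albert ℝ, X.det ≠ 0 ∧ Y = X.sq}

end Albert

/-- The exceptional tube domain: `Z = X + iY` with `Y` in the positive cone. -/
def exceptionalDomain : Set (Albert ℂ) := {Z | Z.map Complex.im ∈ Albert.posCone}

/-! ### The group of type `E_{7,3}` and its action on the exceptional domain -/

/-- The `56`-dimensional space of quadruples `(X, ξ, X', ξ')`. -/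
abbrev Freud (R : Type*) : Type _ := Albert R × R × Albert R × R

namespace Freud

/-- The quartic form
`(X × X, X' × X') - ξ det X - ξ' det X' - ((X, X') - ξ ξ')² / 4`. -/
noncomputable def quartic (w : Freud ℝ) : ℝ :=
  let X := w.1
  let ξ := w.2.1
  let X' := w.2.2.1
  let ξ' := w.2.2.2
  Albert.inner X.sharp X'.sharp - ξ * X.det - ξ' * X'.det
    - (Albert.inner X X' - ξ * ξ') ^ 2 / 4

/-- The alternating form
`(X₁, X₂') - (X₂, X₁') + ξ₁ ξ₂' - ξ₂ ξ₁'`. -/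
def symp (w₁ w₂ : Freud ℝ) : ℝ :=
  Albert.inner w₁.1 w₂.2.2.1 - Albert.inner w₂.1 w₁.2.2.1
    + w₁.2.1 * w₂.2.2.2 - w₂.2.1 * w₁.2.2.2

/-- Apply a map to all the coordinates. -/
def map {R S : Type*} (f : R → S) (w : Freud R) : Freud S :=
  (w.1.map f, f w.2.1, w.2.2.1.map f, f w.2.2.2)

/-- The lattice of integral quadruples. -/
def IsIntegral (w : Freud ℝ) : Prop :=
  w.1.IsIntegral ∧ (∃ n : ℤ, w.2.1 = n) ∧ w.2.2.1.IsIntegral ∧ ∃ n : ℤ, w.2.2.2 = n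

end Freud

/-- The real group `E_{7,3}(ℝ)`: the linear automorphisms of the `56`-dimensional space that
preserve the quartic form and the alternating form. -/
noncomputable def E7R : Subgroup (Freud ℝ ≃ₗ[ℝ] Freud ℝ) where
  carrier := {g | (∀ w, (g w).quartic = w.quartic) ∧ ∀ w₁ w₂, (g w₁).symp (g w₂) = w₁.symp w₂}
  one_mem' := ⟨fun _ => rfl, fun _ _ => rfl⟩
  mul_mem' := by
    rintro g h ⟨hg, hg'⟩ ⟨hh, hh'⟩
    exact ⟨fun w => (hg (h w)).trans (hh w), fun w₁ w₂ => (hg' (h w₁) (h w₂)).trans (hh' w₁ w₂)⟩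
  inv_mem' := by
    rintro g ⟨hg, hg'⟩
    refine ⟨fun w => ?_, fun w₁ w₂ => ?_⟩
    · have h := hg (g.symm w)
      rw [LinearEquiv.apply_symm_apply] at h
      exact h.symm
    · have h := hg' (g.symm w₁) (g.symm w₂)
      rw [LinearEquiv.apply_symm_apply, LinearEquiv.apply_symm_apply] at h
      exact h.symm

/-- The arithmetic group `E_{7,3}(ℤ)`: the stabilizer of the integral lattice in
`E_{7,3}(ℝ)`. -/
noncomputable def E7Z : Subgroup E7R where
  carrier := {g | ∀ w, (g.1 w).IsIntegral ↔ w.IsIntegral}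
  one_mem' := fun _ => Iff.rfl
  mul_mem' := by
    intro g h hg hh w
    exact (hg (h.1 w)).trans (hh w)
  inv_mem' := by
    intro g hg w
    have h := hg (g.1.symm w)
    rw [LinearEquiv.apply_symm_apply] at h
    exact h.symm

/-- The `ℂ`-linear extension of a linear automorphism, applied to a complex quadruple `w`:
`g(Re w) + i g(Im w)`. -/
noncomputable def complexApply (g : Freud ℝ ≃ₗ[ℝ] Freud ℝ) (w : Freud ℂ) : Freud ℂ :=
  (g (w.map Complex.re)).map Complex.ofReal
    + Complex.I • (g (w.map Complex.im)).map Complex.ofReal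

/-- The quadruple `(Z, det Z, Z × Z, 1)` attached to a point `Z`. For `g` in `E_{7,3}(ℝ)` and `Z`
in the exceptional domain, `g (Z, det Z, Z × Z, 1) = j(g, Z) (gZ, det gZ, gZ × gZ, 1)`, which
is the definition of the action and of the automorphy factor. -/
def vec (Z : Albert ℂ) : Freud ℂ := (Z, Z.det, Z.sharp, 1)

/-- The canonical factor of automorphy `j(g, Z)`. -/
noncomputable def autFactor (g : E7R) (Z : Albert ℂ) : ℂ := (complexApply g.1 (vec Z)).2.2.2

/-- The action of `E_{7,3}(ℝ)` on the exceptional domain. -/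
noncomputable def act (g : E7R) (Z : Albert ℂ) : Albert ℂ :=
  (autFactor g Z)⁻¹ • (complexApply g.1 (vec Z)).1

/-- Holomorphic modular forms of weight `k` on the exceptional domain for a subgroup `Γ` of
`E_{7,3}(ℝ)`. Only the values of `F` on the exceptional domain matter. -/
structure IsModularForm (Γ : Subgroup E7R) (k : ℤ) (F : Albert ℂ → ℂ) : Prop where
  holo : DifferentiableOn ℂ F exceptionalDomain
  slash : ∀ γ ∈ Γ, ∀ Z ∈ exceptionalDomain, F (act γ Z) = autFactor γ Z ^ k * F Z

/-- The Jordan algebra of `2 × 2` Hermitian octonionic matrices: `(![a, b], x)` is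
`(a, x; conj x, b)`. -/
abbrev Albert₂ (R : Type*) : Type _ := (Fin 2 → R) × Oct R

namespace Albert₂

/-- The matrix square. -/
def sq {R : Type*} [CommRing R] (X : Albert₂ R) : Albert₂ R :=
  (![X.1 0 ^ 2 + Oct.normSq X.2, Oct.normSq X.2 + X.1 1 ^ 2], (X.1 0 + X.1 1) • X.2)

/-- The determinant. -/
def det {R : Type*} [CommRing R] (X : Albert₂ R) : R := X.1 0 * X.1 1 - Oct.normSq X.2

/-- The open cone of positive elements: the squares of the elements of nonzero determinant. -/
def posCone : Set (Albert₂ ℝ) := {Y | ∃ X : Albert₂ ℝ, X.det ≠ 0 ∧ Y = X.sq}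

/-- The block diagonal element with blocks `Z` and `t`. -/
def block {R : Type*} [CommRing R] (Z : Albert₂ R) (t : R) : Albert R :=
  (![Z.1 0, Z.1 1, t], ![Z.2, 0, 0])

end Albert₂

/-- The tube domain for `Spin(2, 10)`. -/
def exceptionalDomain₂ : Set (Albert₂ ℂ) :=
  {Z | ((fun i => (Z.1 i).im, fun j => (Z.2 j).im) : Albert₂ ℝ) ∈ Albert₂.posCone}

/-- Cusp forms of level one and weight `k` on the exceptional domain: modular forms for
`E_{7,3}(ℤ)` annihilated by the operator `Φ`,
`Φ(F)(Z) = lim F (Z, 0; 0, τ)` as `Im τ → ∞`, `Z` in the tube domain for `Spin(2, 10)`. -/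
structure IsCuspForm (k : ℤ) (F : Albert ℂ → ℂ) : Prop where
  modular : IsModularForm E7Z k F
  cusp : ∀ Z ∈ exceptionalDomain₂, Filter.Tendsto (fun τ : UpperHalfPlane => F (Z.block (τ : ℂ)))
    UpperHalfPlane.atImInfty (nhds 0)

/-! ### Siegel modular forms of degree three -/

/-- The Siegel upper half space of degree `n`. -/
def siegelHalfSpace (n : ℕ) : Set (Matrix (Fin n) (Fin n) ℂ) :=
  {Z | Z.IsSymm ∧ (Z.map Complex.im).PosDef}

/-- The real symplectic group of rank three. -/
abbrev SpR : Type := Matrix.symplecticGroup (Fin 3) ℝ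

/-- The Siegel modular group `Sp_6(ℤ)`, as a subgroup of `Sp_6(ℝ)`. -/
def SpZ : Subgroup SpR where
  carrier := {γ | ∃ δ : Matrix.symplecticGroup (Fin 3) ℤ, γ.1 = δ.1.map (Int.castRingHom ℝ)}
  one_mem' := ⟨1, by simp⟩
  mul_mem' := by
    rintro γ γ' ⟨δ, h⟩ ⟨δ', h'⟩
    refine ⟨δ * δ', ?_⟩
    change γ.1 * γ'.1 = (δ.1 * δ'.1).map (Int.castRingHom ℝ)
    rw [Matrix.map_mul, h, h']
  inv_mem' := by
    rintro γ ⟨δ, h⟩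
    refine ⟨δ⁻¹, ?_⟩
    change (γ⁻¹).1 = (δ⁻¹).1.map (Int.castRingHom ℝ)
    rw [SymplecticGroup.coe_inv, SymplecticGroup.coe_inv, Matrix.map_mul,
      Matrix.map_mul, Matrix.map_neg _ (by simp), Matrix.map_J, Matrix.transpose_map, h]

/-- `C Z + D` for `γ = (A, B; C, D)`. -/
def siegelDenom (γ : SpR) (Z : Matrix (Fin 3) (Fin 3) ℂ) : Matrix (Fin 3) (Fin 3) ℂ :=
  γ.1.toBlocks₂₁.map Complex.ofReal * Z + γ.1.toBlocks₂₂.map Complex.ofReal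

/-- The action `(A Z + B) (C Z + D)⁻¹` for `γ = (A, B; C, D)`. -/
noncomputable def siegelAct (γ : SpR) (Z : Matrix (Fin 3) (Fin 3) ℂ) : Matrix (Fin 3) (Fin 3) ℂ :=
  (γ.1.toBlocks₁₁.map Complex.ofReal * Z + γ.1.toBlocks₁₂.map Complex.ofReal)
    * (siegelDenom γ Z)⁻¹

/-- Holomorphic Siegel modular forms of degree three and weight `k` for a subgroup `Γ` of
`Sp_6(ℝ)`. Only the values of `f` on the Siegel upper half space matter; complex differentiability
is along that set, which is open in the space of symmetric matrices. -/
structure IsSiegelModularForm (Γ : Subgroup SpR) (k : ℤ) (f : Matrix (Fin 3) (Fin 3) ℂ → ℂ) :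
    Prop where
  holo : DifferentiableOn ℂ f (siegelHalfSpace 3)
  slash : ∀ γ ∈ Γ, ∀ Z ∈ siegelHalfSpace 3,
    f (siegelAct γ Z) = (siegelDenom γ Z).det ^ k * f Z

/-- The block diagonal matrix with blocks `Z` and `t`. -/
def siegelBlock (Z : Matrix (Fin 2) (Fin 2) ℂ) (t : ℂ) : Matrix (Fin 3) (Fin 3) ℂ :=
  !![Z 0 0, Z 0 1, 0; Z 1 0, Z 1 1, 0; 0, 0, t]

/-- Siegel cusp forms of degree three, level one and weight `k`: modular forms for `Sp_6(ℤ)`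
annihilated by the Siegel operator `Φ`. -/
structure IsSiegelCuspForm (k : ℤ) (f : Matrix (Fin 3) (Fin 3) ℂ → ℂ) : Prop where
  modular : IsSiegelModularForm SpZ k f
  cusp : ∀ Z ∈ siegelHalfSpace 2,
    Filter.Tendsto (fun τ : UpperHalfPlane => f (siegelBlock Z (τ : ℂ)))
      UpperHalfPlane.atImInfty (nhds 0)

/-! ### Restriction -/

/-- A symmetric matrix `Z` as an element of the exceptional Jordan algebra. -/
def ofSymm (Z : Matrix (Fin 3) (Fin 3) ℂ) : Albert ℂ :=
  (![Z 0 0, Z 1 1, Z 2 2], ![Oct.scalar (Z 0 1), Oct.scalar (Z 0 2), Oct.scalar (Z 1 2)])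

/-- The restriction of `F` to the Siegel upper half space of degree three. -/
def restrict (F : Albert ℂ → ℂ) (Z : Matrix (Fin 3) (Fin 3) ℂ) : ℂ := F (ofSymm Z)

end E7

/-! On symmetric matrices with scalar entries the determinant and adjugate of the Jordan algebra are
the ordinary ones. Hence, writing v(Z) = (Z, det Z, Z × Z, 1), it suffices to find, for each γ = (A,
B; C, D) in Sp_6(ℤ), some g in E_{7,3}(ℤ) with g v(Z) = det(CZ + D) v(γZ) on the Siegel half space.
The transformation law of F under g, read on scalar matrices, is then the law of the restriction
under γ, with the same weight.

No homomorphism from Sp_6 to E_{7,3} is constructed. The pairs (γ, g) related in this way form a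
group, `compatible`, so partners are needed only for generators of Sp_6(ℤ). By
`eq_top_of_symJ_mem_of_spTranslate_mem` these are J and the integral translations Z ↦ Z + S. The
partner of J is the explicit `weylE7`, acting as Z ↦ -Z⁻¹; that of a translation is the polynomial
map `translateE7`. The main computation is `quartic_translate`: translations preserve the quartic
form, by the composition law of the octonions. Together this gives `map_fst_compatible`: the
integral pairs project onto all of Sp_6(ℤ).

For Γ commensurable with E_{7,3}(ℤ), the integral pairs with second entry in Γ have finite index
among all integral pairs, and finite index survives projection to Sp_6; this is
`commensurable_map_fst`. A block diagonal symmetric matrix is a block diagonal element of the Jordan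
algebra, so the limit defining Siegel cusp forms is a special case of the exceptional one. -/

namespace E7

/-! ### Octonion identities for the polar form of the norm. -/

namespace Oct

variable {α : Type*}

theorem ext_coord {R : Type*} {x y : Oct R} (h₀ : x 0 = y 0) (h₁ : x 1 = y 1) (h₂ : x 2 = y 2)
    (h₃ : x 3 = y 3) (h₄ : x 4 = y 4) (h₅ : x 5 = y 5) (h₆ : x 6 = y 6) (h₇ : x 7 = y 7) :
    x = y := by
  funext i
  fin_cases i <;> assumption

theorem vec3_zero (a b c : α) : ![a, b, c] 0 = a := rfl
theorem vec3_one (a b c : α) : ![a, b, c] 1 = b := rfl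
theorem vec3_two (a b c : α) : ![a, b, c] 2 = c := rfl
theorem vec8_zero (a b c d e f g h : α) : ![a, b, c, d, e, f, g, h] 0 = a := rfl
theorem vec8_one (a b c d e f g h : α) : ![a, b, c, d, e, f, g, h] 1 = b := rfl
theorem vec8_two (a b c d e f g h : α) : ![a, b, c, d, e, f, g, h] 2 = c := rfl
theorem vec8_three (a b c d e f g h : α) : ![a, b, c, d, e, f, g, h] 3 = d := rfl
theorem vec8_four (a b c d e f g h : α) : ![a, b, c, d, e, f, g, h] 4 = e := rfl
theorem vec8_five (a b c d e f g h : α) : ![a, b, c, d, e, f, g, h] 5 = f := rfl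
theorem vec8_six (a b c d e f g h : α) : ![a, b, c, d, e, f, g, h] 6 = g := rfl
theorem vec8_seven (a b c d e f g h : α) : ![a, b, c, d, e, f, g, h] 7 = h := rfl

end Oct

set_option linter.unusedSimpArgs false
open Oct

namespace Oct

variable {R : Type*} [CommRing R]

/-- The polar form `Tr(x ȳ)` of the norm. -/
def polar (x y : Oct R) : R := tr (mul x (conj y))

theorem polar_eq (x y : Oct R) : polar x y = 2 * (x 0 * y 0 + x 1 * y 1 + x 2 * y 2 + x 3 * y 3
    + x 4 * y 4 + x 5 * y 5 + x 6 * y 6 + x 7 * y 7) := by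
  simp only [polar, tr, mul, conj, vec8_zero, vec8_one, vec8_two, vec8_three, vec8_four, vec8_five,
    vec8_six, vec8_seven]
  ring

theorem polar_comm (x y : Oct R) : polar x y = polar y x := by
  simp only [polar_eq]
  ring

theorem polar_add_left (x y z : Oct R) : polar (x + y) z = polar x z + polar y z := by
  simp only [polar_eq, Pi.add_apply]
  ring

theorem polar_smul_left (r : R) (x z : Oct R) : polar (r • x) z = r * polar x z := by
  simp only [polar_eq, Pi.smul_apply, smul_eq_mul]
  ring

theorem polar_sub_left (x y z : Oct R) : polar (x - y) z = polar x z - polar y z := by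
  simp only [polar_eq, Pi.sub_apply]
  ring

theorem polar_add_right (x y z : Oct R) : polar z (x + y) = polar z x + polar z y := by
  simp only [polar_eq, Pi.add_apply]
  ring

theorem polar_smul_right (r : R) (x z : Oct R) : polar z (r • x) = r * polar z x := by
  simp only [polar_eq, Pi.smul_apply, smul_eq_mul]
  ring

theorem polar_sub_right (x y z : Oct R) : polar z (x - y) = polar z x - polar z y := by
  simp only [polar_eq, Pi.sub_apply]
  ring

theorem polar_scalar (x : Oct R) (r : R) : polar x (scalar r) = 2 * r * x 0 := by
  simp only [polar_eq, scalar, vec8_zero, vec8_one, vec8_two, vec8_three, vec8_four, vec8_five,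
    vec8_six, vec8_seven]
  ring

theorem polar_scalar_left (x : Oct R) (r : R) : polar (scalar r) x = 2 * r * x 0 := by
  rw [polar_comm, polar_scalar]

theorem scalar_apply_zero (r : R) : scalar r 0 = r := rfl

theorem normSq_eq (x : Oct R) : normSq x = x 0 ^ 2 + x 1 ^ 2 + x 2 ^ 2 + x 3 ^ 2 + x 4 ^ 2 + x 5 ^ 2
    + x 6 ^ 2 + x 7 ^ 2 :=
  Fin.sum_univ_eight _

theorem normSq_add (x y : Oct R) : normSq (x + y) = normSq x + polar x y + normSq y := by
  simp only [polar_eq, normSq_eq, Pi.add_apply]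
  ring

theorem normSq_sub (x y : Oct R) : normSq (x - y) = normSq x - polar x y + normSq y := by
  simp only [polar_eq, normSq_eq, Pi.sub_apply]
  ring

theorem normSq_smul (r : R) (x : Oct R) : normSq (r • x) = r ^ 2 * normSq x := by
  simp only [normSq_eq, Pi.smul_apply, smul_eq_mul]
  ring

theorem normSq_scalar (r : R) : normSq (scalar r) = r ^ 2 := by
  simp only [normSq_eq, scalar, vec8_zero, vec8_one, vec8_two, vec8_three, vec8_four, vec8_five,
    vec8_six, vec8_seven]
  ring

theorem normSq_conj (x : Oct R) : normSq (conj x) = normSq x := by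
  simp only [normSq_eq, conj, vec8_zero, vec8_one, vec8_two, vec8_three, vec8_four, vec8_five,
    vec8_six, vec8_seven]
  ring

theorem conj_conj (x : Oct R) : conj (conj x) = x := by
  apply ext_coord <;> simp only [conj, vec8_zero, vec8_one, vec8_two, vec8_three, vec8_four, vec8_five, vec8_six,
    vec8_seven, neg_neg]

theorem conj_add (x y : Oct R) : conj (x + y) = conj x + conj y := by
  apply ext_coord <;> simp only [conj, Pi.add_apply, vec8_zero, vec8_one, vec8_two, vec8_three,
    vec8_four, vec8_five, vec8_six, vec8_seven] <;> ring

theorem conj_sub (x y : Oct R) : conj (x - y) = conj x - conj y := by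
  apply ext_coord <;> simp only [conj, Pi.sub_apply, vec8_zero, vec8_one, vec8_two, vec8_three,
    vec8_four, vec8_five, vec8_six, vec8_seven] <;> ring

theorem conj_smul (r : R) (x : Oct R) : conj (r • x) = r • conj x := by
  apply ext_coord <;> simp only [conj, Pi.smul_apply, smul_eq_mul, vec8_zero, vec8_one, vec8_two,
    vec8_three, vec8_four, vec8_five, vec8_six, vec8_seven] <;> ring

theorem conj_scalar (r : R) : conj (scalar r) = scalar r := by
  apply ext_coord <;> simp only [conj, scalar, vec8_zero, vec8_one, vec8_two, vec8_three, vec8_four, vec8_five, vec8_six,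
    vec8_seven, neg_zero]

protected theorem mul_add (x y z : Oct R) : mul x (y + z) = mul x y + mul x z := by
  apply ext_coord <;> simp only [mul, Pi.add_apply, vec8_zero, vec8_one, vec8_two, vec8_three,
    vec8_four, vec8_five, vec8_six, vec8_seven] <;> ring

protected theorem add_mul (x y z : Oct R) : mul (x + y) z = mul x z + mul y z := by
  apply ext_coord <;> simp only [mul, Pi.add_apply, vec8_zero, vec8_one, vec8_two, vec8_three,
    vec8_four, vec8_five, vec8_six, vec8_seven] <;> ring

protected theorem mul_sub (x y z : Oct R) : mul x (y - z) = mul x y - mul x z := by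
  apply ext_coord <;> simp only [mul, Pi.sub_apply, vec8_zero, vec8_one, vec8_two, vec8_three,
    vec8_four, vec8_five, vec8_six, vec8_seven] <;> ring

protected theorem sub_mul (x y z : Oct R) : mul (x - y) z = mul x z - mul y z := by
  apply ext_coord <;> simp only [mul, Pi.sub_apply, vec8_zero, vec8_one, vec8_two, vec8_three,
    vec8_four, vec8_five, vec8_six, vec8_seven] <;> ring

protected theorem mul_smul (r : R) (x y : Oct R) : mul x (r • y) = r • mul x y := by
  apply ext_coord <;> simp only [mul, Pi.smul_apply, smul_eq_mul, vec8_zero, vec8_one, vec8_two,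
    vec8_three, vec8_four, vec8_five, vec8_six, vec8_seven] <;> ring

theorem smul_mul (r : R) (x y : Oct R) : mul (r • x) y = r • mul x y := by
  apply ext_coord <;> simp only [mul, Pi.smul_apply, smul_eq_mul, vec8_zero, vec8_one, vec8_two,
    vec8_three, vec8_four, vec8_five, vec8_six, vec8_seven] <;> ring

theorem scalar_mul (r : R) (x : Oct R) : mul (scalar r) x = r • x := by
  apply ext_coord <;> simp only [mul, scalar, Pi.smul_apply, smul_eq_mul, vec8_zero, vec8_one,
    vec8_two, vec8_three, vec8_four, vec8_five, vec8_six, vec8_seven] <;> ring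

theorem conj_apply_zero (x : Oct R) : conj x 0 = x 0 := rfl

theorem polar_conj (x y : Oct R) : polar (conj x) (conj y) = polar x y := by
  simp only [polar_eq, conj, vec8_zero, vec8_one, vec8_two, vec8_three, vec8_four, vec8_five,
    vec8_six, vec8_seven]
  ring

theorem conj_mul (x y : Oct R) : conj (mul x y) = mul (conj y) (conj x) := by
  apply ext_coord <;> simp only [mul, conj, vec8_zero, vec8_one, vec8_two, vec8_three, vec8_four,
    vec8_five, vec8_six, vec8_seven] <;> ring

theorem polar_self (x : Oct R) : polar x x = 2 * normSq x := by
  simp only [polar_eq, normSq_eq]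
  ring

/-- Multiplication by z̄ on the right is adjoint to multiplication by z on the right. With
`polar_conj_mul`, the same fact on the left, this makes the cubic term of the determinant a single
trilinear form in x, y, z. -/
theorem polar_mul_conj (x y z : Oct R) : polar (mul y (conj z)) x = polar (mul x z) y := by
  simp only [polar_eq, mul, conj, vec8_zero, vec8_one, vec8_two, vec8_three, vec8_four, vec8_five,
    vec8_six, vec8_seven]
  ring

theorem polar_conj_mul (x y z : Oct R) : polar (mul (conj x) y) z = polar (mul x z) y := by
  simp only [polar_eq, mul, conj, vec8_zero, vec8_one, vec8_two, vec8_three, vec8_four, vec8_five,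
    vec8_six, vec8_seven]
  ring

/-- The composition law N(xz) = N(x)N(z), polarised in the first factor; `polar_mul_mul_swap` is its
full polarisation. -/
theorem polar_mul_mul_right (x y z : Oct R) :
    polar (mul x z) (mul y z) = normSq z * polar x y := by
  simp only [polar_eq, normSq_eq, mul, vec8_zero, vec8_one, vec8_two, vec8_three, vec8_four,
    vec8_five, vec8_six, vec8_seven]
  ring

/-- The adjoint of left multiplication by x is left multiplication by x̄ = 2x₀ - x. -/
theorem polar_mul_swap (x y z : Oct R) :
    polar (mul x y) z = 2 * x 0 * polar y z - polar (mul x z) y := by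
  simp only [polar_eq, mul, vec8_zero, vec8_one, vec8_two, vec8_three, vec8_four, vec8_five,
    vec8_six, vec8_seven]
  ring

theorem polar_mul_self (x y : Oct R) : polar (mul x y) y = 2 * x 0 * normSq y := by
  simp only [polar_eq, normSq_eq, mul, vec8_zero, vec8_one, vec8_two, vec8_three, vec8_four,
    vec8_five, vec8_six, vec8_seven]
  ring

theorem polar_mul_mul_swap (x x' y z : Oct R) :
    polar (mul x z) (mul x' y) = polar x x' * polar y z - polar (mul x y) (mul x' z) := by
  simp only [polar_eq, mul, vec8_zero, vec8_one, vec8_two, vec8_three, vec8_four, vec8_five,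
    vec8_six, vec8_seven]
  ring

theorem polar_conj_mul_conj_mul (x x' y z : Oct R) :
    polar (mul (conj x) y) (mul (conj x') z) = 4 * x 0 * x' 0 * polar y z
      - 2 * x 0 * polar (mul x' z) y - 2 * x' 0 * polar (mul x y) z
      + polar (mul x y) (mul x' z) := by
  simp only [polar_eq, mul, conj, vec8_zero, vec8_one, vec8_two, vec8_three, vec8_four, vec8_five,
    vec8_six, vec8_seven]
  ring

/-- The polarised composition law exchanges z̄ and z̄', after which z z̄ = N(z) is a scalar. -/
theorem polar_mul_conj_mul_conj (y z z' : Oct R) :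
    polar (mul y (conj z)) (mul z (conj z')) = polar z z' * polar y z - normSq z * polar y z' := by
  simp only [polar_eq, normSq_eq, mul, conj, vec8_zero, vec8_one, vec8_two, vec8_three, vec8_four,
    vec8_five, vec8_six, vec8_seven]
  ring

theorem polar_conj_mul_self (x y : Oct R) : polar (mul (conj x) y) y = 2 * x 0 * normSq y := by
  simp only [polar_eq, normSq_eq, mul, conj, vec8_zero, vec8_one, vec8_two, vec8_three, vec8_four,
    vec8_five, vec8_six, vec8_seven]
  ring

end Oct

/-! ### Translations preserve the alternating and the quartic form. -/

namespace Freud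

theorem ext_coord {R : Type*} {w w' : Freud R} (h₁ : ∀ i, w.1.1 i = w'.1.1 i)
    (h₂ : ∀ i j, w.1.2 i j = w'.1.2 i j) (h₃ : w.2.1 = w'.2.1)
    (h₄ : ∀ i, w.2.2.1.1 i = w'.2.2.1.1 i) (h₅ : ∀ i j, w.2.2.1.2 i j = w'.2.2.1.2 i j)
    (h₆ : w.2.2.2 = w'.2.2.2) : w = w' :=
  Prod.ext (Prod.ext (funext h₁) (funext fun i => funext (h₂ i)))
    (Prod.ext h₃ (Prod.ext (Prod.ext (funext h₄) (funext fun i => funext (h₅ i))) h₆))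

section CommRing

variable {R : Type*} [CommRing R]

/-- The unipotent transformation of quadruples which sends `(Z, det Z, Z × Z, 1)` to the quadruple of
`Z + S`, where `S` is the symmetric scalar matrix with diagonal `s` and off-diagonal entries `u`. -/
def translate (s u : Fin 3 → R) (w : Freud R) : Freud R :=
  let X := w.1
  let X' := w.2.2.1
  let t := w.2.2.2
  ((![X.1 0 + t * s 0, X.1 1 + t * s 1, X.1 2 + t * s 2],
    ![X.2 0 + Oct.scalar (t * u 0), X.2 1 + Oct.scalar (t * u 1), X.2 2 + Oct.scalar (t * u 2)]),
   w.2.1 + (X'.1 0 * s 0 + X'.1 1 * s 1 + X'.1 2 * s 2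
      + 2 * (X'.2 0 0 * u 0 + X'.2 1 0 * u 1 + X'.2 2 0 * u 2))
    + (X.1 0 * (s 1 * s 2 - u 2 ^ 2) + X.1 1 * (s 0 * s 2 - u 1 ^ 2)
      + X.1 2 * (s 0 * s 1 - u 0 ^ 2)
      + 2 * (X.2 0 0 * (u 1 * u 2 - s 2 * u 0) + X.2 1 0 * (u 0 * u 2 - s 1 * u 1)
        + X.2 2 0 * (u 0 * u 1 - s 0 * u 2)))
    + t * (s 0 * s 1 * s 2 - s 0 * u 2 ^ 2 - s 1 * u 1 ^ 2 - s 2 * u 0 ^ 2 + 2 * u 0 * u 1 * u 2),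
   (![X'.1 0 + (X.1 1 * s 2 + X.1 2 * s 1 - 2 * X.2 2 0 * u 2) + t * (s 1 * s 2 - u 2 ^ 2),
      X'.1 1 + (X.1 0 * s 2 + X.1 2 * s 0 - 2 * X.2 1 0 * u 1) + t * (s 0 * s 2 - u 1 ^ 2),
      X'.1 2 + (X.1 0 * s 1 + X.1 1 * s 0 - 2 * X.2 0 0 * u 0) + t * (s 0 * s 1 - u 0 ^ 2)],
    ![X'.2 0 + u 2 • X.2 1 + u 1 • Oct.conj (X.2 2) - s 2 • X.2 0
        + Oct.scalar (t * (u 1 * u 2 - s 2 * u 0) - X.1 2 * u 0),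
      X'.2 1 + u 0 • X.2 2 + u 2 • X.2 0 - s 1 • X.2 1
        + Oct.scalar (t * (u 0 * u 2 - s 1 * u 1) - X.1 1 * u 1),
      X'.2 2 + u 0 • X.2 1 + u 1 • Oct.conj (X.2 0) - s 0 • X.2 2
        + Oct.scalar (t * (u 0 * u 1 - s 0 * u 2) - X.1 0 * u 2)]),
   t)

/-- Translations form a commutative group. This gives their inverses and reduces the invariance of
the quartic form to one parameter at a time. -/
theorem translate_translate (s u s' u' : Fin 3 → R) (w : Freud R) :
    translate s u (translate s' u' w) = translate (s + s') (u + u') w := by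
  refine ext_coord (fun i => ?_) (fun i j => ?_) ?_ (fun i => ?_) (fun i j => ?_) rfl
  all_goals first | (fin_cases i <;> fin_cases j) | fin_cases i | skip
  all_goals simp only [translate, Oct.scalar, Oct.conj, Pi.add_apply, Pi.sub_apply, Pi.smul_apply,
    Prod.fst_add, Prod.snd_add, Prod.smul_fst, Prod.smul_snd, smul_eq_mul, Fin.zero_eta,
    Fin.mk_one, Fin.reduceFinMk, Fin.isValue, vec3_zero, vec3_one, vec3_two, vec8_zero, vec8_one,
    vec8_two, vec8_three, vec8_four, vec8_five, vec8_six, vec8_seven]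
  all_goals ring

theorem translate_zero (w : Freud R) : translate 0 0 w = w := by
  refine ext_coord (fun i => ?_) (fun i j => ?_) ?_ (fun i => ?_) (fun i j => ?_) rfl
  all_goals first | (fin_cases i <;> fin_cases j) | fin_cases i | skip
  all_goals simp only [translate, Oct.scalar, Oct.conj, Pi.add_apply, Pi.sub_apply, Pi.smul_apply,
    Prod.fst_add, Prod.snd_add, Prod.smul_fst, Prod.smul_snd, smul_eq_mul, Fin.zero_eta,
    Fin.mk_one, Fin.reduceFinMk, Fin.isValue, vec3_zero, vec3_one, vec3_two, vec8_zero, vec8_one,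
    vec8_two, vec8_three, vec8_four, vec8_five, vec8_six, vec8_seven, Pi.zero_apply]
  all_goals ring

theorem translate_add (s u : Fin 3 → R) (w w' : Freud R) :
    translate s u (w + w') = translate s u w + translate s u w' := by
  refine ext_coord (fun i => ?_) (fun i j => ?_) ?_ (fun i => ?_) (fun i j => ?_) rfl
  all_goals first | (fin_cases i <;> fin_cases j) | fin_cases i | skip
  all_goals simp only [translate, Oct.scalar, Oct.conj, Pi.add_apply, Pi.sub_apply, Pi.smul_apply,
    Prod.fst_add, Prod.snd_add, Prod.smul_fst, Prod.smul_snd, smul_eq_mul, Fin.zero_eta,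
    Fin.mk_one, Fin.reduceFinMk, Fin.isValue, vec3_zero, vec3_one, vec3_two, vec8_zero, vec8_one,
    vec8_two, vec8_three, vec8_four, vec8_five, vec8_six, vec8_seven]
  all_goals ring

theorem translate_smul (s u : Fin 3 → R) (c : R) (w : Freud R) :
    translate s u (c • w) = c • translate s u w := by
  refine ext_coord (fun i => ?_) (fun i j => ?_) ?_ (fun i => ?_) (fun i j => ?_) rfl
  all_goals first | (fin_cases i <;> fin_cases j) | fin_cases i | skip
  all_goals simp only [translate, Oct.scalar, Oct.conj, Pi.add_apply, Pi.sub_apply, Pi.smul_apply,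
    Prod.fst_add, Prod.snd_add, Prod.smul_fst, Prod.smul_snd, smul_eq_mul, Fin.zero_eta,
    Fin.mk_one, Fin.reduceFinMk, Fin.isValue, vec3_zero, vec3_one, vec3_two, vec8_zero, vec8_one,
    vec8_two, vec8_three, vec8_four, vec8_five, vec8_six, vec8_seven]
  all_goals ring

end CommRing

theorem symp_translate (s u : Fin 3 → ℝ) (w w' : Freud ℝ) :
    (translate s u w).symp (translate s u w') = w.symp w' := by
  simp only [symp, translate, Oct.scalar, Oct.conj, Pi.add_apply, Pi.sub_apply, Pi.smul_apply,
    Prod.fst_add, Prod.snd_add, Prod.smul_fst, Prod.smul_snd, smul_eq_mul, Fin.zero_eta,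
    Fin.mk_one, Fin.reduceFinMk, Fin.isValue, vec3_zero, vec3_one, vec3_two, vec8_zero, vec8_one, vec8_two, vec8_three,
    vec8_four, vec8_five, vec8_six, vec8_seven, Albert.inner, Oct.mul, Oct.tr, Fin.sum_univ_three]
  ring

/-- The quartic form in terms of the octonionic entries. -/
theorem quartic_mk (a b c a' b' c' ξ ξ' : ℝ) (x y z x' y' z' : Oct ℝ) :
    quartic ((![a, b, c], ![x, y, z]), ξ, (![a', b', c'], ![x', y', z']), ξ')
      = (b * c - normSq z) * (b' * c' - normSq z') + (a * c - normSq y) * (a' * c' - normSq y')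
        + (a * b - normSq x) * (a' * b' - normSq x')
        + polar (mul y (conj z) - c • x) (mul y' (conj z') - c' • x')
        + polar (mul x z - b • y) (mul x' z' - b' • y')
        + polar (mul (conj x) y - a • z) (mul (conj x') y' - a' • z')
        - ξ * (a * b * c - a * normSq z - b * normSq y - c * normSq x + polar (mul x z) y)
        - ξ' * (a' * b' * c' - a' * normSq z' - b' * normSq y' - c' * normSq x'
          + polar (mul x' z') y')
        - (a * a' + b * b' + c * c' + polar x x' + polar y y' + polar z z' - ξ * ξ') ^ 2 / 4 := by
  simp only [quartic, Albert.inner, Albert.sharp, Albert.det, polar, Fin.sum_univ_three, vec3_zero,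
    vec3_one, vec3_two]
  ring

theorem eq_mk {R : Type*} (w : Freud R) :
    w = ((![w.1.1 0, w.1.1 1, w.1.1 2], ![w.1.2 0, w.1.2 1, w.1.2 2]), w.2.1,
      (![w.2.2.1.1 0, w.2.2.1.1 1, w.2.2.1.1 2], ![w.2.2.1.2 0, w.2.2.1.2 1, w.2.2.1.2 2]),
      w.2.2.2) := by
  refine ext_coord (fun i => ?_) (fun i j => ?_) rfl (fun i => ?_) (fun i j => ?_) rfl <;>
    fin_cases i <;> rfl

/-- Once everything is expanded in polar forms, `h₁` to `h₆` (the composition law and adjointness)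
bring the products of octonions to a common shape, and the powers of t cancel as a commutative
polynomial identity. -/
theorem quartic_translate_diag_zero (t : ℝ) (w : Freud ℝ) :
    (translate ![t, 0, 0] ![0, 0, 0] w).quartic = w.quartic := by
  have h : translate ![t, 0, 0] ![0, 0, 0] w =
      ((![w.1.1 0 + t * w.2.2.2, w.1.1 1, w.1.1 2], ![w.1.2 0, w.1.2 1, w.1.2 2]),
        w.2.1 + t * w.2.2.1.1 0,
        (![w.2.2.1.1 0, w.2.2.1.1 1 + t * w.1.1 2, w.2.2.1.1 2 + t * w.1.1 1],
          ![w.2.2.1.2 0, w.2.2.1.2 1, w.2.2.1.2 2 - t • w.1.2 2]), w.2.2.2) := by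
    refine ext_coord (fun i => ?_) (fun i j => ?_) ?_ (fun i => ?_) (fun i j => ?_) rfl
    all_goals first | (fin_cases i <;> fin_cases j) | fin_cases i | skip
    all_goals simp only [translate, Oct.scalar, Oct.conj, Pi.add_apply, Pi.sub_apply,
      Pi.smul_apply, Prod.fst_add, Prod.snd_add, Prod.smul_fst, Prod.smul_snd, smul_eq_mul,
      Fin.zero_eta, Fin.mk_one, Fin.reduceFinMk, Fin.isValue, vec3_zero, vec3_one, vec3_two,
      vec8_zero, vec8_one, vec8_two, vec8_three, vec8_four, vec8_five, vec8_six, vec8_seven,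
      mul_zero, zero_mul]
    all_goals ring
  rw [h, quartic_mk]
  conv_rhs => rw [eq_mk w, quartic_mk]
  generalize w.1.1 0 = a, w.1.1 1 = b, w.1.1 2 = c, w.1.2 0 = x, w.1.2 1 = y, w.1.2 2 = z,
    w.2.1 = ξ, w.2.2.1.1 0 = a', w.2.2.1.1 1 = b', w.2.2.1.1 2 = c', w.2.2.1.2 0 = x',
    w.2.2.1.2 1 = y', w.2.2.1.2 2 = z', w.2.2.2 = ξ'
  have h₁ := polar_mul_mul_right y y' (conj z)
  have h₂ := polar_mul_mul_right x x' z
  have h₃ := polar_mul_conj x' y z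
  have h₄ := polar_mul_conj x y' z
  have h₅ := polar_conj_mul x y z
  have h₆ := polar_conj_mul x' y' z
  rw [polar_comm] at h₄ h₆
  rw [normSq_conj] at h₁
  rw [polar_comm _ y] at h₃
  simp only [polar_add_left, polar_add_right, polar_sub_left, polar_sub_right, polar_smul_left,
    polar_smul_right, normSq_sub, normSq_smul, conj_sub, conj_smul, Oct.mul_sub, Oct.mul_smul, polar_self, h₁, h₂, h₃,
    h₄, h₅, h₆]
  rw [polar_comm z' z]
  ring

theorem quartic_translate_offDiag_zero (t : ℝ) (w : Freud ℝ) :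
    (translate ![0, 0, 0] ![t, 0, 0] w).quartic = w.quartic := by
  have h : translate ![0, 0, 0] ![t, 0, 0] w =
      ((![w.1.1 0, w.1.1 1, w.1.1 2], ![w.1.2 0 + scalar (t * w.2.2.2), w.1.2 1, w.1.2 2]),
        w.2.1 + 2 * t * w.2.2.1.2 0 0 - t ^ 2 * w.1.1 2,
        (![w.2.2.1.1 0, w.2.2.1.1 1,
            w.2.2.1.1 2 - 2 * t * w.1.2 0 0 - t ^ 2 * w.2.2.2],
          ![w.2.2.1.2 0 - scalar (t * w.1.1 2), w.2.2.1.2 1 + t • w.1.2 2,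
            w.2.2.1.2 2 + t • w.1.2 1]), w.2.2.2) := by
    refine ext_coord (fun i => ?_) (fun i j => ?_) ?_ (fun i => ?_) (fun i j => ?_) rfl
    all_goals first | (fin_cases i <;> fin_cases j) | fin_cases i | skip
    all_goals simp only [translate, Oct.scalar, Oct.conj, Pi.add_apply, Pi.sub_apply,
      Pi.smul_apply, Prod.fst_add, Prod.snd_add, Prod.smul_fst, Prod.smul_snd, smul_eq_mul,
      Fin.zero_eta, Fin.mk_one, Fin.reduceFinMk, Fin.isValue, vec3_zero, vec3_one, vec3_two,
      vec8_zero, vec8_one, vec8_two, vec8_three, vec8_four, vec8_five, vec8_six, vec8_seven,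
      mul_zero, zero_mul]
    all_goals ring
  rw [h, quartic_mk]
  conv_rhs => rw [eq_mk w, quartic_mk]
  generalize w.1.1 0 = a, w.1.1 1 = b, w.1.1 2 = c, w.1.2 0 = x, w.1.2 1 = y, w.1.2 2 = z,
    w.2.1 = ξ, w.2.2.1.1 0 = a', w.2.2.1.1 1 = b', w.2.2.1.1 2 = c', w.2.2.1.2 0 = x',
    w.2.2.1.2 1 = y', w.2.2.1.2 2 = z', w.2.2.2 = ξ'
  simp only [polar_add_left, polar_add_right, polar_sub_left, polar_sub_right, polar_smul_left,
    polar_smul_right, normSq_add, normSq_sub, normSq_smul, normSq_scalar, conj_add, conj_sub,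
    conj_smul, conj_scalar, Oct.add_mul, Oct.sub_mul, Oct.mul_add, Oct.mul_sub, Oct.mul_smul, smul_mul, scalar_mul,
    polar_scalar, polar_scalar_left, Pi.add_apply, Pi.sub_apply, Pi.smul_apply, smul_eq_mul,
    scalar_apply_zero]
  -- The following rules normalise every remaining product: conjugates are eliminated and the
  -- arguments of each trilinear expression are put in a fixed order, so that `ring` sees equal
  -- terms as equal.
  have mul_conj_zero : ∀ u v : Oct ℝ, mul u (conj v) 0 = polar u v / 2 := fun u v => by
    rw [polar, tr]
    ring
  have h₁ : polar (mul y (conj z)) (mul y' (conj y))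
      = polar y y' * polar y z - normSq y * polar y' z := by
    rw [polar_comm, polar_mul_conj_mul_conj, polar_comm y' y]
    ring
  have h₂ : ∀ u v : Oct ℝ, polar x (mul u (conj v)) = polar (mul x v) u := fun u v => by
    rw [polar_comm, polar_mul_conj]
  have h₃ : ∀ v : Oct ℝ, polar y (mul (conj x') v) = polar (mul x' y) v := fun v => by
    rw [polar_comm, polar_conj_mul]
  have h₄ : ∀ v : Oct ℝ, polar z (mul (conj x') v) = polar (mul x' z) v := fun v => by
    rw [polar_comm, polar_conj_mul]
  have h₅ : ∀ v : Oct ℝ, polar y (mul x' v) = polar (mul x' v) y := fun v => polar_comm _ _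
  have h₆ : ∀ v : Oct ℝ, polar z (mul x' v) = polar (mul x' v) z := fun v => polar_comm _ _
  simp only [mul_conj_zero, h₁, h₂, h₃, h₄, h₅, h₆, polar_mul_conj x' y z,
    polar_mul_conj_mul_conj y z z', polar_mul_conj_mul_conj y z y, polar_mul_mul_swap x x' y z,
    polar_conj_mul_conj_mul x x' y z, polar_conj_mul x y z, polar_conj_mul x y z',
    polar_conj_mul x y y', polar_conj_mul_self, polar_mul_self, polar_self,
    polar_mul_swap x y' y, polar_mul_swap x z' z, polar_mul_swap x y z, polar_mul_swap x' y z,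
    polar_mul_swap x' y' y, polar_mul_swap x' z' z, polar_comm z y, polar_comm y' y,
    polar_comm z' z, polar_comm y' z, polar_comm z' y, polar_comm z' y', conj_apply_zero]
  ring

/-- Exchanging the first two rows and columns of a Hermitian matrix replaces x by x̄ and
interchanges y and z. This symmetry `f` preserves the quartic form, since conjugation reverses
products, and carries translations to translations. With the analogous exchange of the last two
indices, all one-parameter translations reduce to one diagonal and one off-diagonal case. -/
theorem quartic_translate_of_swap_zero_one {s u : Fin 3 → ℝ}
    (h : ∀ w : Freud ℝ, (translate ![s 1, s 0, s 2] ![u 0, u 2, u 1] w).quartic = w.quartic)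
    (w : Freud ℝ) : (translate s u w).quartic = w.quartic := by
  let f : Freud ℝ → Freud ℝ := fun w =>
    ((![w.1.1 1, w.1.1 0, w.1.1 2], ![conj (w.1.2 0), w.1.2 2, w.1.2 1]), w.2.1,
      (![w.2.2.1.1 1, w.2.2.1.1 0, w.2.2.1.1 2],
        ![conj (w.2.2.1.2 0), w.2.2.1.2 2, w.2.2.1.2 1]), w.2.2.2)
  have hq : ∀ w, (f w).quartic = w.quartic := by
    intro w
    have e : ∀ (c : ℝ) (x y z : Oct ℝ), mul z (conj y) - c • conj x
        = conj (mul y (conj z) - c • x) := fun c x y z => by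
      rw [conj_sub, conj_smul, Oct.conj_mul, conj_conj]
    conv_rhs => rw [eq_mk w, quartic_mk]
    rw [quartic_mk, e, e, polar_conj, polar_conj, polar_conj_mul, polar_conj_mul, conj_conj,
      conj_conj, normSq_conj, normSq_conj]
    ring
  have hf : translate ![s 1, s 0, s 2] ![u 0, u 2, u 1] (f w) = f (translate s u w) := by
    refine ext_coord (fun i => ?_) (fun i j => ?_) ?_ (fun i => ?_) (fun i j => ?_) rfl
    all_goals first | (fin_cases i <;> fin_cases j) | fin_cases i | skip
    all_goals simp only [f, translate, Oct.scalar, Oct.conj, Pi.add_apply, Pi.sub_apply,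
      Pi.smul_apply, Prod.fst_add, Prod.snd_add, Prod.smul_fst, Prod.smul_snd, smul_eq_mul,
      Fin.zero_eta, Fin.mk_one, Fin.reduceFinMk, Fin.isValue, vec3_zero, vec3_one, vec3_two,
      vec8_zero, vec8_one, vec8_two, vec8_three, vec8_four, vec8_five, vec8_six, vec8_seven]
    all_goals ring
  rw [← hq (translate s u w), ← hf, h, hq]

theorem quartic_translate_of_swap_one_two {s u : Fin 3 → ℝ}
    (h : ∀ w : Freud ℝ, (translate ![s 0, s 2, s 1] ![u 1, u 0, u 2] w).quartic = w.quartic)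
    (w : Freud ℝ) : (translate s u w).quartic = w.quartic := by
  let f : Freud ℝ → Freud ℝ := fun w =>
    ((![w.1.1 0, w.1.1 2, w.1.1 1], ![w.1.2 1, w.1.2 0, conj (w.1.2 2)]), w.2.1,
      (![w.2.2.1.1 0, w.2.2.1.1 2, w.2.2.1.1 1],
        ![w.2.2.1.2 1, w.2.2.1.2 0, conj (w.2.2.1.2 2)]), w.2.2.2)
  have hq : ∀ w, (f w).quartic = w.quartic := by
    intro w
    have e : ∀ (a : ℝ) (x y z : Oct ℝ), mul (conj y) x - a • conj z
        = conj (mul (conj x) y - a • z) := fun a x y z => by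
      rw [conj_sub, conj_smul, Oct.conj_mul, conj_conj]
    conv_rhs => rw [eq_mk w, quartic_mk]
    rw [quartic_mk, e, e, polar_conj, polar_conj, polar_mul_conj, polar_mul_conj, conj_conj,
      conj_conj, normSq_conj, normSq_conj]
    ring
  have hf : translate ![s 0, s 2, s 1] ![u 1, u 0, u 2] (f w) = f (translate s u w) := by
    refine ext_coord (fun i => ?_) (fun i j => ?_) ?_ (fun i => ?_) (fun i j => ?_) rfl
    all_goals first | (fin_cases i <;> fin_cases j) | fin_cases i | skip
    all_goals simp only [f, translate, Oct.scalar, Oct.conj, Pi.add_apply, Pi.sub_apply,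
      Pi.smul_apply, Prod.fst_add, Prod.snd_add, Prod.smul_fst, Prod.smul_snd, smul_eq_mul,
      Fin.zero_eta, Fin.mk_one, Fin.reduceFinMk, Fin.isValue, vec3_zero, vec3_one, vec3_two,
      vec8_zero, vec8_one, vec8_two, vec8_three, vec8_four, vec8_five, vec8_six, vec8_seven]
    all_goals ring
  rw [← hq (translate s u w), ← hf, h, hq]

theorem quartic_translate_diag_one (t : ℝ) :
    ∀ w : Freud ℝ, (translate ![0, t, 0] ![0, 0, 0] w).quartic = w.quartic :=
  quartic_translate_of_swap_zero_one (quartic_translate_diag_zero t)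

theorem quartic_translate_diag_two (t : ℝ) :
    ∀ w : Freud ℝ, (translate ![0, 0, t] ![0, 0, 0] w).quartic = w.quartic :=
  quartic_translate_of_swap_one_two (quartic_translate_diag_one t)

theorem quartic_translate_offDiag_one (t : ℝ) :
    ∀ w : Freud ℝ, (translate ![0, 0, 0] ![0, t, 0] w).quartic = w.quartic :=
  quartic_translate_of_swap_one_two (quartic_translate_offDiag_zero t)

theorem quartic_translate_offDiag_two (t : ℝ) :
    ∀ w : Freud ℝ, (translate ![0, 0, 0] ![0, 0, t] w).quartic = w.quartic :=
  quartic_translate_of_swap_zero_one (quartic_translate_offDiag_one t)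

end Freud
namespace Freud

theorem quartic_translate (s u : Fin 3 → ℝ) (w : Freud ℝ) :
    (translate s u w).quartic = w.quartic := by
  -- Zero summands pad both sums to six terms, so that each step of `translate_translate` splits off
  -- exactly one parameter.
  have hs : s = ![s 0, 0, 0] + (![0, s 1, 0] + (![0, 0, s 2] + (![0, 0, 0] +
      (![0, 0, 0] + ![0, 0, 0])))) := by
    funext i; fin_cases i <;> simp
  have hu : u = ![0, 0, 0] + (![0, 0, 0] + (![0, 0, 0] + (![u 0, 0, 0] +
      (![0, u 1, 0] + ![0, 0, u 2])))) := by
    funext i; fin_cases i <;> simp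
  rw [hs, hu]
  simp only [← translate_translate]
  rw [quartic_translate_diag_zero, quartic_translate_diag_one, quartic_translate_diag_two,
    quartic_translate_offDiag_zero, quartic_translate_offDiag_one, quartic_translate_offDiag_two]

/-- `translate` as a linear automorphism. -/
def translateEquiv (s u : Fin 3 → ℝ) : Freud ℝ ≃ₗ[ℝ] Freud ℝ where
  toFun := translate s u
  invFun := translate (-s) (-u)
  map_add' := translate_add s u
  map_smul' := translate_smul s u
  left_inv w := by rw [translate_translate, neg_add_cancel, neg_add_cancel, translate_zero]
  right_inv w := by rw [translate_translate, add_neg_cancel, add_neg_cancel, translate_zero]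

/-- The linear automorphism `(X, ξ, X', ξ') ↦ (-X', -ξ', X, ξ)`. -/
def weylEquiv : Freud ℝ ≃ₗ[ℝ] Freud ℝ where
  toFun w := (-w.2.2.1, -w.2.2.2, w.1, w.2.1)
  invFun w := (w.2.2.1, w.2.2.2, -w.1, -w.2.1)
  map_add' w w' := by
    refine Prod.ext ?_ (Prod.ext ?_ rfl)
    · exact neg_add _ _
    · exact neg_add _ _
  map_smul' c w := by
    refine Prod.ext ?_ (Prod.ext ?_ rfl)
    · exact (smul_neg _ _).symm
    · exact (smul_neg _ _).symm
  left_inv w := by simp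
  right_inv w := by simp

end Freud

/-! ### The inversion preserves both forms. -/

namespace Albert

variable {R : Type*} [CommRing R]

theorem inner_neg_left (X Y : Albert R) : inner (-X) Y = -inner X Y := by
  simp only [inner, Oct.mul, Oct.conj, Oct.tr, Fin.sum_univ_three, vec8_zero, vec8_one, vec8_two,
    vec8_three, vec8_four, vec8_five, vec8_six, vec8_seven, Prod.fst_neg, Prod.snd_neg,
    Pi.neg_apply]
  ring

theorem inner_comm (X Y : Albert R) : inner X Y = inner Y X := by
  simp only [inner, Oct.mul, Oct.conj, Oct.tr, Fin.sum_univ_three, vec8_zero, vec8_one, vec8_two,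
    vec8_three, vec8_four, vec8_five, vec8_six, vec8_seven]
  ring

theorem det_neg (X : Albert R) : det (-X) = -det X := by
  simp only [det, Oct.mul, Oct.conj, Oct.tr, Oct.normSq, Fin.sum_univ_eight, vec8_zero, vec8_one,
    vec8_two, vec8_three, vec8_four, vec8_five, vec8_six, vec8_seven, Prod.fst_neg, Prod.snd_neg,
    Pi.neg_apply]
  ring

theorem sharp_neg (X : Albert R) : sharp (-X) = sharp X := by
  refine Prod.ext (funext fun i => ?_) (funext fun i => funext fun j => ?_)
  · fin_cases i <;>
      simp only [sharp, Oct.normSq, Prod.fst_neg, Prod.snd_neg, Pi.neg_apply, Fin.zero_eta,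
        Fin.mk_one, Fin.reduceFinMk, Fin.isValue, vec3_zero, vec3_one, vec3_two, neg_mul_neg,
        neg_sq]
  · fin_cases i <;> fin_cases j <;>
      simp only [sharp, Oct.mul, Oct.conj, Prod.fst_neg, Prod.snd_neg, Pi.neg_apply, Fin.zero_eta,
        Fin.mk_one, Fin.reduceFinMk, Fin.isValue, vec3_zero, vec3_one, vec3_two, vec8_zero,
        vec8_one, vec8_two, vec8_three, vec8_four, vec8_five, vec8_six, vec8_seven, Pi.sub_apply,
        Pi.smul_apply, smul_eq_mul] <;>
      ring

end Albert

namespace Freud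

theorem quartic_weylEquiv (w : Freud ℝ) : (weylEquiv w).quartic = w.quartic := by
  simp only [quartic, weylEquiv, LinearEquiv.coe_mk, LinearMap.coe_mk, AddHom.coe_mk,
    Albert.sharp_neg, Albert.det_neg, Albert.inner_neg_left]
  rw [Albert.inner_comm w.2.2.1.sharp, Albert.inner_comm w.2.2.1]
  ring

theorem symp_weylEquiv (w w' : Freud ℝ) : (weylEquiv w).symp (weylEquiv w') = w.symp w' := by
  simp only [symp, weylEquiv, LinearEquiv.coe_mk, LinearMap.coe_mk, AddHom.coe_mk,
    Albert.inner_neg_left]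
  rw [Albert.inner_comm w.2.2.1, Albert.inner_comm w'.2.2.1]
  ring

end Freud

/-- The translation by the symmetric scalar matrix with diagonal `s` and off-diagonal `u`. -/
def translateE7 (s u : Fin 3 → ℝ) : E7R :=
  ⟨Freud.translateEquiv s u, Freud.quartic_translate s u, Freud.symp_translate s u⟩

/-- The element of `E_{7,3}(ℝ)` which acts by `Z ↦ -Z⁻¹`. -/
def weylE7 : E7R := ⟨Freud.weylEquiv, Freud.quartic_weylEquiv, Freud.symp_weylEquiv⟩

/-! ### Integrality -/

namespace Oct

theorem one_mem_integral : scalar 1 ∈ integral :=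
  AddSubgroup.subset_closure ⟨0, rfl⟩

theorem scalar_int_mem_integral (n : ℤ) : scalar (n : ℝ) ∈ integral := by
  have h : scalar (n : ℝ) = n • scalar 1 := by
    funext j; fin_cases j <;> simp [scalar]
  rw [h]
  exact zsmul_mem one_mem_integral n

theorem int_smul_mem_integral (n : ℤ) {x : Oct ℝ} (hx : x ∈ integral) :
    (n : ℝ) • x ∈ integral := by
  rw [Int.cast_smul_eq_zsmul]
  exact zsmul_mem hx n

/-- Integrality of the trace, checked on the basis. Real parts may be half-integers, but in the
numerical components of `translate` they occur only doubled. -/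
theorem exists_two_mul_eq_of_mem_integral {x : Oct ℝ} (hx : x ∈ integral) :
    ∃ n : ℤ, 2 * x 0 = n := by
  induction hx using AddSubgroup.closure_induction with
  | mem x hx =>
    obtain ⟨i, rfl⟩ := hx
    fin_cases i
    exacts [⟨2, by simp [intBasis]⟩, ⟨0, by simp [intBasis]⟩, ⟨0, by simp [intBasis]⟩,
      ⟨0, by simp [intBasis]⟩, ⟨0, by simp [intBasis]⟩, ⟨-1, by simp [intBasis]; norm_num⟩,
      ⟨-1, by simp [intBasis]; norm_num⟩, ⟨-1, by simp [intBasis]; norm_num⟩]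
  | zero => exact ⟨0, by simp⟩
  | add x y _ _ hx hy =>
    obtain ⟨m, hm⟩ := hx
    obtain ⟨n, hn⟩ := hy
    exact ⟨m + n, by rw [Pi.add_apply, mul_add, hm, hn, Int.cast_add]⟩
  | neg x _ hx =>
    obtain ⟨m, hm⟩ := hx
    exact ⟨-m, by rw [Pi.neg_apply, mul_neg, hm, Int.cast_neg]⟩

theorem conj_mem_integral {x : Oct ℝ} (hx : x ∈ integral) : conj x ∈ integral := by
  obtain ⟨n, hn⟩ := exists_two_mul_eq_of_mem_integral hx
  -- Conjugation is x̄ = Tr(x) - x, and both terms are integral.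
  have h : conj x = scalar (n : ℝ) - x := by
    rw [← hn]
    funext j; fin_cases j <;> simp [conj, scalar]; ring
  rw [h]
  exact sub_mem (scalar_int_mem_integral n) hx

end Oct

namespace Freud

theorem IsIntegral.translate {w : Freud ℝ} (hw : w.IsIntegral) (s u : Fin 3 → ℤ) :
    (translate (fun i => (s i : ℝ)) (fun i => (u i : ℝ)) w).IsIntegral := by
  obtain ⟨⟨ha, hx⟩, ⟨m, hm⟩, ⟨ha', hx'⟩, ⟨n, hn⟩⟩ := hw
  choose a ha using ha
  choose a' ha' using ha'
  choose b hb using fun i => exists_two_mul_eq_of_mem_integral (hx i)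
  choose b' hb' using fun i => exists_two_mul_eq_of_mem_integral (hx' i)
  have hz : ∀ r : ℝ, (∃ k : ℤ, r = k) → Oct.scalar r ∈ Oct.integral := by
    rintro r ⟨k, rfl⟩
    exact scalar_int_mem_integral k
  refine ⟨⟨fun i => ?_, fun i => ?_⟩, ?_, ⟨fun i => ?_, fun i => ?_⟩, n, hn⟩
  · fin_cases i
    exacts [⟨a 0 + n * s 0, by simp [Freud.translate, ha, hn]⟩,
      ⟨a 1 + n * s 1, by simp [Freud.translate, ha, hn]⟩,
      ⟨a 2 + n * s 2, by simp [Freud.translate, ha, hn]⟩]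
  · fin_cases i
    exacts [add_mem (hx 0) (hz _ ⟨n * u 0, by simp [hn]⟩),
      add_mem (hx 1) (hz _ ⟨n * u 1, by simp [hn]⟩), add_mem (hx 2) (hz _ ⟨n * u 2, by simp [hn]⟩)]
  · refine ⟨m + (a' 0 * s 0 + a' 1 * s 1 + a' 2 * s 2 + (b' 0 * u 0 + b' 1 * u 1 + b' 2 * u 2))
      + (a 0 * (s 1 * s 2 - u 2 ^ 2) + a 1 * (s 0 * s 2 - u 1 ^ 2) + a 2 * (s 0 * s 1 - u 0 ^ 2)
        + (b 0 * (u 1 * u 2 - s 2 * u 0) + b 1 * (u 0 * u 2 - s 1 * u 1)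
          + b 2 * (u 0 * u 1 - s 0 * u 2)))
      + n * (s 0 * s 1 * s 2 - s 0 * u 2 ^ 2 - s 1 * u 1 ^ 2 - s 2 * u 0 ^ 2
        + 2 * u 0 * u 1 * u 2), ?_⟩
    push_cast
    simp only [Freud.translate, ← hb, ← hb', ← ha, ← ha', ← hm, ← hn]
    ring
  · fin_cases i
    · refine ⟨a' 0 + (a 1 * s 2 + a 2 * s 1 - b 2 * u 2) + n * (s 1 * s 2 - u 2 ^ 2), ?_⟩
      push_cast
      simp only [Freud.translate, ← hb, ← ha, ← ha', ← hn, vec3_zero]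
    · refine ⟨a' 1 + (a 0 * s 2 + a 2 * s 0 - b 1 * u 1) + n * (s 0 * s 2 - u 1 ^ 2), ?_⟩
      push_cast
      simp only [Freud.translate, ← hb, ← ha, ← ha', ← hn, vec3_one]
    · refine ⟨a' 2 + (a 0 * s 1 + a 1 * s 0 - b 0 * u 0) + n * (s 0 * s 1 - u 0 ^ 2), ?_⟩
      push_cast
      simp only [Freud.translate, ← hb, ← ha, ← ha', ← hn, vec3_two]
  · have hs : ∀ i j, (s i : ℝ) • w.1.2 j ∈ Oct.integral := fun i j => int_smul_mem_integral _ (hx j)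
    have hu : ∀ i j, (u i : ℝ) • w.1.2 j ∈ Oct.integral := fun i j => int_smul_mem_integral _ (hx j)
    have hc : ∀ i j, (u i : ℝ) • Oct.conj (w.1.2 j) ∈ Oct.integral :=
      fun i j => int_smul_mem_integral _ (conj_mem_integral (hx j))
    fin_cases i
    · exact add_mem (sub_mem (add_mem (add_mem (hx' 0) (hu 2 1)) (hc 1 2)) (hs 2 0))
        (hz _ ⟨n * (u 1 * u 2 - s 2 * u 0) - a 2 * u 0, by push_cast; rw [← hn, ← ha]⟩)
    · exact add_mem (sub_mem (add_mem (add_mem (hx' 1) (hu 0 2)) (hu 2 0)) (hs 1 1))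
        (hz _ ⟨n * (u 0 * u 2 - s 1 * u 1) - a 1 * u 1, by push_cast; rw [← hn, ← ha]⟩)
    · exact add_mem (sub_mem (add_mem (add_mem (hx' 2) (hu 0 1)) (hc 1 0)) (hs 0 2))
        (hz _ ⟨n * (u 0 * u 1 - s 0 * u 2) - a 0 * u 2, by push_cast; rw [← hn, ← ha]⟩)

end Freud

theorem Albert.IsIntegral.neg {X : Albert ℝ} (hX : X.IsIntegral) : (-X).IsIntegral :=
  ⟨fun i => let ⟨n, hn⟩ := hX.1 i; ⟨-n, by simp [hn]⟩, fun i => neg_mem (hX.2 i)⟩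

theorem translateE7_mem (s u : Fin 3 → ℤ) :
    translateE7 (fun i => (s i : ℝ)) (fun i => (u i : ℝ)) ∈ E7Z := by
  refine fun w => ⟨fun h => ?_, fun h => h.translate s u⟩
  -- The inverse translation is integral as well, which gives the converse.
  have h' := Freud.IsIntegral.translate h (-s) (-u)
  have e : Freud.translate (fun i => ((-s) i : ℝ)) (fun i => ((-u) i : ℝ))
      (Freud.translate (fun i => (s i : ℝ)) (fun i => (u i : ℝ)) w) = w := by
    rw [Freud.translate_translate]
    convert Freud.translate_zero w using 2 <;> funext i <;> simp
  exact e ▸ h'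

theorem weylE7_mem : weylE7 ∈ E7Z := by
  intro w
  refine ⟨fun ⟨h₁, ⟨n, hn⟩, h₂, h₃⟩ => ⟨h₂, h₃, ?_, -n, ?_⟩,
    fun ⟨h₁, h₂, h₃, ⟨n, hn⟩⟩ => ⟨h₃.neg, ⟨-n, ?_⟩, h₁, h₂⟩⟩
  · have := h₁.neg
    rwa [show -(weylE7.1 w).1 = w.2.2.1 from neg_neg _] at this
  · rw [Int.cast_neg, ← hn]
    exact (neg_neg _).symm
  · rw [Int.cast_neg, ← hn]
    rfl

/-! ### Complexification -/

theorem Freud.map_re_add_map_im (w : Freud ℂ) :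
    (w.map Complex.re).map Complex.ofReal
      + Complex.I • (w.map Complex.im).map Complex.ofReal = w := by
  refine Freud.ext_coord (fun i => ?_) (fun i j => ?_) ?_ (fun i => ?_) (fun i j => ?_) ?_ <;>
    exact (congrArg _ (mul_comm _ _)).trans (Complex.re_add_im _)

theorem complexApply_re (g : Freud ℝ ≃ₗ[ℝ] Freud ℝ) (w : Freud ℂ) :
    (complexApply g w).map Complex.re = g (w.map Complex.re) := by
  refine Freud.ext_coord (fun i => ?_) (fun i j => ?_) ?_ (fun i => ?_) (fun i j => ?_) ?_ <;>
    simp [complexApply, Freud.map, Albert.map]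

theorem complexApply_im (g : Freud ℝ ≃ₗ[ℝ] Freud ℝ) (w : Freud ℂ) :
    (complexApply g w).map Complex.im = g (w.map Complex.im) := by
  refine Freud.ext_coord (fun i => ?_) (fun i j => ?_) ?_ (fun i => ?_) (fun i j => ?_) ?_ <;>
    simp [complexApply, Freud.map, Albert.map]

theorem complexApply_mul (g h : Freud ℝ ≃ₗ[ℝ] Freud ℝ) (w : Freud ℂ) :
    complexApply (g * h) w = complexApply g (complexApply h w) := by
  conv_rhs => rw [complexApply, complexApply_re, complexApply_im]
  rfl

theorem complexApply_one (w : Freud ℂ) : complexApply 1 w = w :=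
  w.map_re_add_map_im

theorem complexApply_translateEquiv (s u : Fin 3 → ℝ) (w : Freud ℂ) :
    complexApply (Freud.translateEquiv s u) w
      = Freud.translate (fun i => (s i : ℂ)) (fun i => (u i : ℂ)) w := by
  have h : ∀ v : Freud ℝ, (Freud.translate s u v).map Complex.ofReal
      = Freud.translate (fun i => (s i : ℂ)) (fun i => (u i : ℂ)) (v.map Complex.ofReal) := by
    intro v
    refine Freud.ext_coord (fun i => ?_) (fun i j => ?_) ?_ (fun i => ?_) (fun i j => ?_) rfl
    all_goals first | (fin_cases i <;> fin_cases j) | fin_cases i | skip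
    all_goals simp only [Freud.translate, Freud.map, Albert.map, Oct.scalar, Oct.conj,
      Pi.add_apply, Pi.sub_apply, Pi.smul_apply, smul_eq_mul, Fin.zero_eta, Fin.mk_one,
      Fin.reduceFinMk, Fin.isValue, vec3_zero, vec3_one, vec3_two, vec8_zero, vec8_one, vec8_two,
      vec8_three, vec8_four, vec8_five, vec8_six, vec8_seven]
    all_goals push_cast
    all_goals rfl
  conv_rhs => rw [← w.map_re_add_map_im]
  rw [Freud.translate_add, Freud.translate_smul, ← h, ← h]
  rfl

theorem complexApply_weylEquiv (w : Freud ℂ) :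
    complexApply Freud.weylEquiv w = (-w.2.2.1, -w.2.2.2, w.1, w.2.1) := by
  refine Freud.ext_coord (fun i => ?_) (fun i j => ?_) ?_ (fun i => ?_) (fun i j => ?_) ?_ <;>
    simp [complexApply, Freud.weylEquiv, Freud.map, Albert.map, Complex.ext_iff]

open Matrix

/-! ### Translations and the inversion on scalar symmetric matrices -/

/-- The symmetric matrix with diagonal `s` and entries `u` at `(0, 1)`, `(0, 2)`, `(1, 2)`. -/
def symmMatrix {R : Type*} (s u : Fin 3 → R) : Matrix (Fin 3) (Fin 3) R :=
  !![s 0, u 0, u 1; u 0, s 1, u 2; u 1, u 2, s 2]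

theorem translate_vec_ofSymm (s u : Fin 3 → ℂ) (Z : Matrix (Fin 3) (Fin 3) ℂ) :
    Freud.translate s u (vec (ofSymm Z)) = vec (ofSymm (Z + symmMatrix s u)) := by
  have hZS₀ : (Z + symmMatrix s u) 0 0 = Z 0 0 + s 0 := rfl
  have hZS₁ : (Z + symmMatrix s u) 1 1 = Z 1 1 + s 1 := rfl
  have hZS₂ : (Z + symmMatrix s u) 2 2 = Z 2 2 + s 2 := rfl
  have hZS₃ : (Z + symmMatrix s u) 0 1 = Z 0 1 + u 0 := rfl
  have hZS₄ : (Z + symmMatrix s u) 0 2 = Z 0 2 + u 1 := rfl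
  have hZS₅ : (Z + symmMatrix s u) 1 2 = Z 1 2 + u 2 := rfl
  refine Freud.ext_coord (fun i => ?_) (fun i j => ?_) ?_ (fun i => ?_) (fun i j => ?_) rfl
  all_goals first | (fin_cases i <;> fin_cases j) | fin_cases i | skip
  all_goals simp only [Freud.translate, vec, ofSymm, Oct.scalar, Albert.sharp, Albert.det,
    Oct.normSq, Oct.mul, Oct.conj, Oct.tr, Fin.sum_univ_eight, Pi.add_apply, Pi.sub_apply,
    Pi.smul_apply, smul_eq_mul, Fin.zero_eta, Fin.mk_one, Fin.reduceFinMk, Fin.isValue, vec3_zero,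
    vec3_one, vec3_two, vec8_zero, vec8_one, vec8_two, vec8_three, vec8_four, vec8_five, vec8_six,
    vec8_seven, hZS₀, hZS₁, hZS₂, hZS₃, hZS₄, hZS₅]
  all_goals ring

theorem det_ofSymm {Z : Matrix (Fin 3) (Fin 3) ℂ} (hZ : Z.IsSymm) : (ofSymm Z).det = Z.det := by
  simp [Albert.det, ofSymm, Matrix.det_fin_three, Oct.scalar, Oct.normSq, Oct.mul, Oct.conj,
    Oct.tr, Fin.sum_univ_eight, hZ.apply 0 1, hZ.apply 0 2, hZ.apply 1 2]
  ring

theorem sharp_ofSymm {Z : Matrix (Fin 3) (Fin 3) ℂ} (hZ : Z.IsSymm) :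
    (ofSymm Z).sharp = ofSymm Z.adjugate := by
  refine Prod.ext (funext fun i => ?_) (funext fun i => funext fun j => ?_)
  · fin_cases i <;> simp [Albert.sharp, ofSymm, Matrix.adjugate_fin_three, Oct.scalar, Oct.normSq,
      Fin.sum_univ_eight, hZ.apply 0 1, hZ.apply 0 2, hZ.apply 1 2] <;> ring
  · fin_cases i <;> fin_cases j <;> simp [Albert.sharp, ofSymm, Matrix.adjugate_fin_three,
      Oct.scalar, Oct.mul, Oct.conj, hZ.apply 0 1, hZ.apply 0 2, hZ.apply 1 2] <;> ring

theorem ofSymm_smul (c : ℂ) (Z : Matrix (Fin 3) (Fin 3) ℂ) : ofSymm (c • Z) = c • ofSymm Z := by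
  refine Prod.ext (funext fun i => ?_) (funext fun i => funext fun j => ?_)
  · fin_cases i <;> simp [ofSymm]
  · fin_cases i <;> fin_cases j <;> simp [ofSymm, Oct.scalar]

/-- Since Z × Z = det(Z) Z⁻¹, taking det Z out of (-Z × Z, -1, Z, det Z) leaves the quadruple of
-Z⁻¹. -/
theorem weyl_vec_ofSymm {Z : Matrix (Fin 3) (Fin 3) ℂ} (hZ : Z.IsSymm) (hd : Z.det ≠ 0) :
    complexApply Freud.weylEquiv (vec (ofSymm Z)) = Z.det • vec (ofSymm (-Z⁻¹)) := by
  have hi : -Z⁻¹ = (-Z.det⁻¹) • Z.adjugate := by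
    rw [Matrix.inv_def, Ring.inverse_eq_inv', neg_smul]
  have hs : (-Z⁻¹).IsSymm := by
    rw [Matrix.IsSymm, Matrix.transpose_neg, Matrix.transpose_nonsing_inv, hZ.eq]
  have had : (-Z⁻¹).adjugate = Z.det⁻¹ • Z := by
    rw [hi, Matrix.adjugate_smul, Matrix.adjugate_adjugate _ (by simp)]
    simp only [Fintype.card_fin, smul_smul]
    congr 1
    norm_num
    field_simp
  have hdt : (-Z⁻¹).det = -Z.det⁻¹ := by
    rw [Matrix.det_neg, Matrix.det_nonsing_inv, Ring.inverse_eq_inv']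
    simp [pow_succ]
  rw [complexApply_weylEquiv, vec, vec, sharp_ofSymm hZ, det_ofSymm hZ, det_ofSymm hs,
    sharp_ofSymm hs, had, hdt, hi, ofSymm_smul, ofSymm_smul]
  refine Prod.ext ?_ (Prod.ext ?_ (Prod.ext ?_ ?_))
  · simp [smul_smul, hd]
  · simp [hd]
  · simp [smul_smul, hd]
  · simp

/-! ### The relation between `Sp_6(ℝ)` and `E_{7,3}(ℝ)` -/

/-- The cone over the orbit of `Sp_6(ℝ)` on the Siegel half space: the `6 × 3` matrices
`γ (Z; 1)`. -/
def siegelCone : Set (Matrix (Fin 3 ⊕ Fin 3) (Fin 3) ℂ) :=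
  {M | ∃ γ : SpR, ∃ Z ∈ siegelHalfSpace 3, M = γ.1.map Complex.ofReal * fromRows Z (1 : Matrix (Fin 3) (Fin 3) ℂ)}

theorem mul_mem_siegelCone (γ : SpR) {M : Matrix (Fin 3 ⊕ Fin 3) (Fin 3) ℂ}
    (hM : M ∈ siegelCone) : γ.1.map Complex.ofReal * M ∈ siegelCone := by
  obtain ⟨δ, Z, hZ, rfl⟩ := hM
  refine ⟨γ * δ, Z, hZ, ?_⟩
  rw [← Matrix.mul_assoc]
  congr 1
  exact (Matrix.map_mul (f := Complex.ofRealHom)).symm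

/-- The quadruple attached to a `6 × 3` matrix `(P; Q)`, namely `det Q` times the quadruple of
`P Q⁻¹`. -/
noncomputable def coneVec (M : Matrix (Fin 3 ⊕ Fin 3) (Fin 3) ℂ) : Freud ℂ :=
  M.toRows₂.det • vec (ofSymm (M.toRows₁ * M.toRows₂⁻¹))

/-- The real part of the Hermitian form at v is the sum of the values of the real form Y at Re v and
Im v. -/
theorem dotProduct_star_mulVec_eq_zero {n : Type*} [Fintype n] {Y : Matrix n n ℝ} (hY : Y.PosDef)
    {v : n → ℂ} (h : star v ⬝ᵥ (Y.map Complex.ofReal *ᵥ v) = 0) : v = 0 := by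
  have hre : (star v ⬝ᵥ (Y.map Complex.ofReal *ᵥ v)).re =
      (fun i => (v i).re) ⬝ᵥ (Y *ᵥ fun i => (v i).re)
        + (fun i => (v i).im) ⬝ᵥ (Y *ᵥ fun i => (v i).im) := by
    simp only [dotProduct, mulVec, Complex.re_sum, Complex.mul_re, Complex.im_sum, Complex.mul_im,
      Pi.star_apply, RCLike.star_def, Complex.conj_re, Complex.conj_im, Matrix.map_apply,
      Complex.ofReal_re, Complex.ofReal_im, zero_mul, sub_zero, add_zero,
      ← Finset.sum_add_distrib]
    exact Finset.sum_congr rfl fun i _ => by ring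
  rw [h, Complex.zero_re] at hre
  by_contra hv
  have h₁ := hY.posSemidef.dotProduct_mulVec_nonneg (fun i => (v i).re)
  have h₂ := hY.posSemidef.dotProduct_mulVec_nonneg (fun i => (v i).im)
  simp only [star_trivial] at h₁ h₂
  have key : (fun i => (v i).re) = 0 ∧ (fun i => (v i).im) = 0 := by
    constructor
    · by_contra h0
      have := hY.dotProduct_mulVec_pos h0
      simp only [star_trivial] at this
      linarith
    · by_contra h0
      have := hY.dotProduct_mulVec_pos h0
      simp only [star_trivial] at this
      linarith
  exact hv (funext fun i => Complex.ext (congrFun key.1 i) (congrFun key.2 i))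

theorem J_mul_fromRows (P Q : Matrix (Fin 3) (Fin 3) ℂ) :
    J (Fin 3) ℂ * fromRows P Q = fromRows (-Q) P := by
  rw [J, fromBlocks_mul_fromRows]
  simp

theorem transpose_mul_J_mul (γ : SpR) :
    (γ.1.map Complex.ofReal)ᵀ * J (Fin 3) ℂ * γ.1.map Complex.ofReal = J (Fin 3) ℂ := by
  have h := SymplecticGroup.mem_iff'.mp γ.2
  have h' := congrArg (fun A => A.map Complex.ofRealHom) h
  rw [Matrix.map_mul, Matrix.map_mul, Matrix.map_J] at h'
  exact h'

/-- MᵀJM is unchanged when M is multiplied on the left by a symplectic matrix, and it vanishes for M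
= (Z; 1) with Z symmetric. -/
theorem siegelCone_isSymm {P Q : Matrix (Fin 3) (Fin 3) ℂ} (h : fromRows P Q ∈ siegelCone) :
    Pᵀ * Q = Qᵀ * P := by
  obtain ⟨γ, Z, hZ, hM⟩ := h
  have h₁ : (fromRows P Q)ᵀ * (J (Fin 3) ℂ * fromRows P Q)
      = (fromRows Z (1 : Matrix (Fin 3) (Fin 3) ℂ))ᵀ * (J (Fin 3) ℂ * fromRows Z (1 : Matrix (Fin 3) (Fin 3) ℂ)) := by
    rw [hM, Matrix.transpose_mul]
    conv_rhs => rw [← transpose_mul_J_mul γ]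
    simp only [Matrix.mul_assoc]
  simp only [J_mul_fromRows, transpose_fromRows, fromCols_mul_fromRows, Matrix.transpose_one,
    hZ.1.eq, Matrix.mul_neg, Matrix.mul_one, Matrix.one_mul, neg_add_cancel] at h₁
  exact neg_add_eq_zero.mp h₁

/-- The Hermitian analogue: γ is real, so MᴴJM is invariant too. -/
theorem siegelCone_conjTranspose {P Q : Matrix (Fin 3) (Fin 3) ℂ}
    (h : fromRows P Q ∈ siegelCone) :
    ∃ Z ∈ siegelHalfSpace 3, Qᴴ * P - Pᴴ * Q = Z - Zᴴ := by
  obtain ⟨γ, Z, hZ, hM⟩ := h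
  have hγ : (γ.1.map Complex.ofReal)ᴴ = (γ.1.map Complex.ofReal)ᵀ := by
    ext i j
    simp
  have h₁ : (fromRows P Q)ᴴ * (J (Fin 3) ℂ * fromRows P Q)
      = (fromRows Z (1 : Matrix (Fin 3) (Fin 3) ℂ))ᴴ * (J (Fin 3) ℂ * fromRows Z (1 : Matrix (Fin 3) (Fin 3) ℂ)) := by
    rw [hM, Matrix.conjTranspose_mul, hγ]
    conv_rhs => rw [← transpose_mul_J_mul γ]
    simp only [Matrix.mul_assoc]
  simp only [J_mul_fromRows, conjTranspose_fromRows_eq_fromCols_conjTranspose,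
    fromCols_mul_fromRows, Matrix.conjTranspose_one, Matrix.mul_neg, Matrix.mul_one,
    Matrix.one_mul] at h₁
  exact ⟨Z, hZ, by rw [sub_eq_neg_add, h₁, ← sub_eq_neg_add]⟩

/-- If Qv = 0, then vᴴ(QᴴP - PᴴQ)v = 0; but this number is 2i vᴴ(Im Z)v for some Z in the half
space, which forces v = 0. -/
theorem siegelCone_det_ne_zero {P Q : Matrix (Fin 3) (Fin 3) ℂ}
    (h : fromRows P Q ∈ siegelCone) : Q.det ≠ 0 := by
  intro hQ
  obtain ⟨Z, hZ, hPQ⟩ := siegelCone_conjTranspose h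
  obtain ⟨v, hv, hQv⟩ := Matrix.exists_mulVec_eq_zero_iff.mpr hQ
  refine hv (dotProduct_star_mulVec_eq_zero hZ.2 ?_)
  have hZ' : Z - Zᴴ = (2 * Complex.I) • (Z.map Complex.im).map Complex.ofReal := by
    ext i j
    have := hZ.1.apply i j
    simp only [Matrix.sub_apply, Matrix.conjTranspose_apply, this, Matrix.smul_apply,
      Matrix.map_apply, smul_eq_mul]
    rw [RCLike.star_def, Complex.sub_conj]
    push_cast
    ring
  have h₁ : star v ⬝ᵥ ((Qᴴ * P - Pᴴ * Q) *ᵥ v) = 0 := by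
    rw [Matrix.sub_mulVec, ← Matrix.mulVec_mulVec, ← Matrix.mulVec_mulVec, hQv,
      Matrix.mulVec_zero, sub_zero, Matrix.dotProduct_mulVec, ← Matrix.star_mulVec, hQv, star_zero,
      zero_dotProduct]
  rw [hPQ, hZ', Matrix.smul_mulVec, dotProduct_smul, smul_eq_mul] at h₁
  simpa using h₁

theorem siegelCone_quotient_isSymm {P Q : Matrix (Fin 3) (Fin 3) ℂ}
    (h : fromRows P Q ∈ siegelCone) : (P * Q⁻¹).IsSymm := by
  have hu : IsUnit Q.det := isUnit_iff_ne_zero.mpr (siegelCone_det_ne_zero h)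
  have hu' : IsUnit (Qᵀ).det := by rwa [Matrix.det_transpose]
  have hs := siegelCone_isSymm h
  rw [Matrix.IsSymm, Matrix.transpose_mul, Matrix.transpose_nonsing_inv]
  calc (Qᵀ)⁻¹ * Pᵀ = (Qᵀ)⁻¹ * (Pᵀ * Q) * Q⁻¹ := by
        rw [Matrix.mul_assoc, Matrix.mul_assoc, Matrix.mul_nonsing_inv _ hu, Matrix.mul_one]
    _ = P * Q⁻¹ := by
        rw [hs, ← Matrix.mul_assoc, Matrix.nonsing_inv_mul _ hu', Matrix.one_mul]

theorem map_mul_fromRows (γ : SpR) (Z : Matrix (Fin 3) (Fin 3) ℂ) :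
    γ.1.map Complex.ofReal * fromRows Z (1 : Matrix (Fin 3) (Fin 3) ℂ)
      = fromRows (γ.1.toBlocks₁₁.map Complex.ofReal * Z + γ.1.toBlocks₁₂.map Complex.ofReal)
          (siegelDenom γ Z) := by
  conv_lhs => rw [← Matrix.fromBlocks_toBlocks γ.1, Matrix.fromBlocks_map]
  rw [Matrix.fromBlocks_mul_fromRows, Matrix.mul_one, Matrix.mul_one]
  rfl

theorem coneVec_mul_fromRows (γ : SpR) (Z : Matrix (Fin 3) (Fin 3) ℂ) :
    coneVec (γ.1.map Complex.ofReal * fromRows Z (1 : Matrix (Fin 3) (Fin 3) ℂ))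
      = (siegelDenom γ Z).det • vec (ofSymm (siegelAct γ Z)) := by
  rw [map_mul_fromRows]
  rfl

theorem siegelDenom_det_ne_zero (γ : SpR) {Z : Matrix (Fin 3) (Fin 3) ℂ}
    (hZ : Z ∈ siegelHalfSpace 3) : (siegelDenom γ Z).det ≠ 0 :=
  siegelCone_det_ne_zero ⟨γ, Z, hZ, (map_mul_fromRows γ Z).symm⟩

theorem fromRows_one_mem_siegelCone {Z : Matrix (Fin 3) (Fin 3) ℂ}
    (hZ : Z ∈ siegelHalfSpace 3) : fromRows Z (1 : Matrix (Fin 3) (Fin 3) ℂ) ∈ siegelCone :=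
  ⟨1, Z, hZ, by
    have : (1 : SpR).1.map Complex.ofReal = 1 := Matrix.map_one _ Complex.ofReal_zero
      Complex.ofReal_one
    rw [this, Matrix.one_mul]⟩

/-- The pairs `(γ, g)` in `Sp_6(ℝ) × E_{7,3}(ℝ)` for which `g` acts on the Siegel half space as
`γ`, with the same factor of automorphy. -/
noncomputable def compatible : Subgroup (SpR × E7R) where
  -- Using 6 × 3 matrices rather than points Z absorbs the factor det(CZ + D): the condition
  -- composes without a cocycle computation, and the cone is stable under Sp_6(ℝ).
  carrier := {p | ∀ M ∈ siegelCone,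
    complexApply p.2.1 (coneVec M) = coneVec (p.1.1.map Complex.ofReal * M)}
  one_mem' M _ := by
    have : (1 : SpR).1.map Complex.ofReal = 1 := Matrix.map_one _ Complex.ofReal_zero
      Complex.ofReal_one
    change complexApply 1 _ = coneVec ((1 : SpR).1.map Complex.ofReal * M)
    rw [this, Matrix.one_mul, complexApply_one]
  mul_mem' := by
    intro p q hp hq M hM
    have : (p.1 * q.1).1.map Complex.ofReal
        = p.1.1.map Complex.ofReal * q.1.1.map Complex.ofReal :=
      Matrix.map_mul (f := Complex.ofRealHom)
    change complexApply (p.2.1 * q.2.1) _ = coneVec ((p.1 * q.1).1.map Complex.ofReal * M)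
    rw [this, complexApply_mul, hq M hM, hp _ (mul_mem_siegelCone q.1 hM), Matrix.mul_assoc]
  inv_mem' := by
    intro p hp M hM
    have h := hp _ (mul_mem_siegelCone p.1⁻¹ hM)
    have h₁ : p.1.1.map Complex.ofReal * (p.1⁻¹).1.map Complex.ofReal = 1 := by
      have : p.1.1 * (p.1⁻¹).1 = 1 := congrArg Subtype.val (mul_inv_cancel p.1)
      have h₂ := congrArg (fun A => A.map Complex.ofRealHom) this
      rw [Matrix.map_mul, Matrix.map_one _ (map_zero _) (map_one _)] at h₂
      exact h₂
    rw [← Matrix.mul_assoc, h₁, Matrix.one_mul] at h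
    change complexApply (p.2.1)⁻¹ _ = coneVec ((p.1⁻¹).1.map Complex.ofReal * M)
    rw [← h, ← complexApply_mul, inv_mul_cancel, complexApply_one]

theorem complexApply_vec_ofSymm {p : SpR × E7R} (hp : p ∈ compatible)
    {Z : Matrix (Fin 3) (Fin 3) ℂ} (hZ : Z ∈ siegelHalfSpace 3) :
    complexApply p.2.1 (vec (ofSymm Z))
      = (siegelDenom p.1 Z).det • vec (ofSymm (siegelAct p.1 Z)) := by
  have h := hp _ (fromRows_one_mem_siegelCone hZ)
  rw [coneVec_mul_fromRows] at h
  rw [← h, coneVec, toRows₁_fromRows, toRows₂_fromRows, Matrix.det_one, one_smul, inv_one,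
    Matrix.mul_one]

theorem autFactor_ofSymm {p : SpR × E7R} (hp : p ∈ compatible)
    {Z : Matrix (Fin 3) (Fin 3) ℂ} (hZ : Z ∈ siegelHalfSpace 3) :
    autFactor p.2 (ofSymm Z) = (siegelDenom p.1 Z).det := by
  rw [autFactor, complexApply_vec_ofSymm hp hZ]
  exact mul_one _

theorem act_ofSymm {p : SpR × E7R} (hp : p ∈ compatible)
    {Z : Matrix (Fin 3) (Fin 3) ℂ} (hZ : Z ∈ siegelHalfSpace 3) :
    act p.2 (ofSymm Z) = ofSymm (siegelAct p.1 Z) := by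
  rw [act, autFactor_ofSymm hp hZ, complexApply_vec_ofSymm hp hZ]
  exact inv_smul_smul₀ (siegelDenom_det_ne_zero p.1 hZ) _

/-- The translation matrix `(1, S; 0, 1)`. -/
def spTranslate {R : Type*} [CommRing R] (s u : Fin 3 → R) : symplecticGroup (Fin 3) R :=
  ⟨fromBlocks 1 (symmMatrix s u) 0 1, by
    have hs : (symmMatrix s u)ᵀ = symmMatrix s u := by
      ext i j
      fin_cases i <;> fin_cases j <;> rfl
    rw [SymplecticGroup.mem_iff, J, fromBlocks_transpose, fromBlocks_multiply,
      fromBlocks_multiply, hs]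
    simp⟩

theorem spTranslate_compatible (s u : Fin 3 → ℝ) :
    (spTranslate s u, translateE7 s u) ∈ compatible := by
  intro M hM
  rw [← fromRows_toRows M] at hM ⊢
  set P := M.toRows₁
  set Q := M.toRows₂
  have hu : IsUnit Q.det := isUnit_iff_ne_zero.mpr (siegelCone_det_ne_zero hM)
  have hS : (symmMatrix s u).map Complex.ofReal
      = symmMatrix (fun i => (s i : ℂ)) (fun i => (u i : ℂ)) := by
    ext i j
    fin_cases i <;> fin_cases j <;> rfl
  have h : (spTranslate s u).1.map Complex.ofReal * fromRows P Q
      = fromRows (P + symmMatrix (fun i => (s i : ℂ)) (fun i => (u i : ℂ)) * Q) Q := by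
    rw [spTranslate, fromBlocks_map, fromBlocks_mul_fromRows, hS]
    simp
  rw [h]
  change complexApply (Freud.translateEquiv s u) _ = _
  rw [complexApply_translateEquiv]
  simp only [coneVec, toRows₁_fromRows, toRows₂_fromRows]
  -- Both sides have lower block Q, and (P + SQ)Q⁻¹ = PQ⁻¹ + S.
  rw [Freud.translate_smul, translate_vec_ofSymm, Matrix.add_mul, Matrix.mul_assoc,
    Matrix.mul_nonsing_inv _ hu, Matrix.mul_one]

theorem weyl_compatible : (SymplecticGroup.symJ (Fin 3) ℝ, weylE7) ∈ compatible := by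
  intro M hM
  have hM' := mul_mem_siegelCone (SymplecticGroup.symJ (Fin 3) ℝ) hM
  rw [← fromRows_toRows M] at hM hM' ⊢
  set P := M.toRows₁
  set Q := M.toRows₂
  have h : (SymplecticGroup.symJ (Fin 3) ℝ).1.map Complex.ofReal * fromRows P Q
      = fromRows (-Q) P := by
    have : (SymplecticGroup.symJ (Fin 3) ℝ).1.map Complex.ofReal = J (Fin 3) ℂ :=
      Matrix.map_J (Fin 3) Complex.ofRealHom
    rw [this, J_mul_fromRows]
  rw [h] at hM' ⊢
  -- P is the lower block of JM, which again lies in the cone.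
  have hP := siegelCone_det_ne_zero hM'
  have hQ := siegelCone_det_ne_zero hM
  have hd : (P * Q⁻¹).det = P.det / Q.det := by
    rw [Matrix.det_mul, Matrix.det_nonsing_inv, Ring.inverse_eq_inv', div_eq_mul_inv]
  change complexApply Freud.weylEquiv _ = _
  have hsmul : ∀ (c : ℂ) (w : Freud ℂ), complexApply Freud.weylEquiv (c • w)
      = c • complexApply Freud.weylEquiv w := by
    intro c w
    simp only [complexApply_weylEquiv]
    refine Prod.ext ?_ (Prod.ext ?_ rfl) <;> exact (smul_neg _ _).symm
  simp only [coneVec, toRows₁_fromRows, toRows₂_fromRows]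
  rw [hsmul, weyl_vec_ofSymm (siegelCone_quotient_isSymm hM) (by rw [hd]; exact div_ne_zero hP hQ),
    smul_smul, hd, mul_div_cancel₀ _ hQ, Matrix.mul_inv_rev,
    Matrix.nonsing_inv_nonsing_inv _ (isUnit_iff_ne_zero.mpr hQ), Matrix.neg_mul]

/-! ### Generators of `Sp_6(ℤ)` -/

/-- The upper unipotent symplectic matrix `(1, S; 0, 1)`. -/
def spUpper {R : Type*} [CommRing R] (S : Matrix (Fin 3) (Fin 3) R) (hS : S.IsSymm) :
    symplecticGroup (Fin 3) R :=
  ⟨fromBlocks 1 S 0 1, by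
    rw [SymplecticGroup.mem_iff, J, fromBlocks_transpose, fromBlocks_multiply,
      fromBlocks_multiply, hS.eq]
    simp⟩

/-- The lower unipotent symplectic matrix `(1, 0; S, 1)`. -/
def spLower {R : Type*} [CommRing R] (S : Matrix (Fin 3) (Fin 3) R) (hS : S.IsSymm) :
    symplecticGroup (Fin 3) R :=
  ⟨fromBlocks 1 0 S 1, by
    rw [SymplecticGroup.mem_iff, J, fromBlocks_transpose, fromBlocks_multiply,
      fromBlocks_multiply, hS.eq]
    simp⟩

/-- The unipotent generators of the integral symplectic group of the coordinates in `I`. -/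
def spUnipotents (I : Finset (Fin 3)) : Set (symplecticGroup (Fin 3) ℤ) :=
  {g | ∃ (S : Matrix (Fin 3) (Fin 3) ℤ) (hS : S.IsSymm),
    (∀ i j, S i j ≠ 0 → i ∈ I ∧ j ∈ I) ∧ (g = spUpper S hS ∨ g = spLower S hS)}

/-- The integral symplectic group of the coordinates in `I`, as generated by its unipotents. -/
def spSub (I : Finset (Fin 3)) : Subgroup (symplecticGroup (Fin 3) ℤ) :=
  Subgroup.closure (spUnipotents I)

theorem spUpper_mulVec_inl (S : Matrix (Fin 3) (Fin 3) ℤ) (hS : S.IsSymm)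
    (v : Fin 3 ⊕ Fin 3 → ℤ) (i : Fin 3) :
    ((spUpper S hS).1 *ᵥ v) (.inl i) = v (.inl i) + ∑ j, S i j * v (.inr j) := by
  simp [spUpper, mulVec, dotProduct, one_apply]

theorem spUpper_mulVec_inr (S : Matrix (Fin 3) (Fin 3) ℤ) (hS : S.IsSymm)
    (v : Fin 3 ⊕ Fin 3 → ℤ) (i : Fin 3) : ((spUpper S hS).1 *ᵥ v) (.inr i) = v (.inr i) := by
  simp [spUpper, fromBlocks_mulVec]

theorem spLower_mulVec_inl (S : Matrix (Fin 3) (Fin 3) ℤ) (hS : S.IsSymm)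
    (v : Fin 3 ⊕ Fin 3 → ℤ) (i : Fin 3) : ((spLower S hS).1 *ᵥ v) (.inl i) = v (.inl i) := by
  simp [spLower, fromBlocks_mulVec]

theorem spLower_mulVec_inr (S : Matrix (Fin 3) (Fin 3) ℤ) (hS : S.IsSymm)
    (v : Fin 3 ⊕ Fin 3 → ℤ) (i : Fin 3) :
    ((spLower S hS).1 *ᵥ v) (.inr i) = v (.inr i) + ∑ j, S i j * v (.inl j) := by
  simp [spLower, mulVec, dotProduct, one_apply, add_comm]

theorem inv_mulVec_mulVec (g : symplecticGroup (Fin 3) ℤ) (v : Fin 3 ⊕ Fin 3 → ℤ) :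
    (g⁻¹).1 *ᵥ (g.1 *ᵥ v) = v := by
  rw [mulVec_mulVec]
  have : (g⁻¹).1 * g.1 = 1 := congrArg Subtype.val (inv_mul_cancel g)
  rw [this, one_mulVec]

theorem mulVec_inv_mulVec (g : symplecticGroup (Fin 3) ℤ) (v : Fin 3 ⊕ Fin 3 → ℤ) :
    g.1 *ᵥ ((g⁻¹).1 *ᵥ v) = v := by
  simpa using inv_mulVec_mulVec g⁻¹ v

theorem mul_mulVec (g h : symplecticGroup (Fin 3) ℤ) (v : Fin 3 ⊕ Fin 3 → ℤ) :
    (g * h).1 *ᵥ v = g.1 *ᵥ (h.1 *ᵥ v) :=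
  (mulVec_mulVec _ _ _).symm

/-- Ensures that clearing a later column with a smaller `I` does not disturb the columns already
cleared. -/
theorem spSub_mulVec_eq_self {I : Finset (Fin 3)} {g : symplecticGroup (Fin 3) ℤ}
    (hg : g ∈ spSub I) {v : Fin 3 ⊕ Fin 3 → ℤ}
    (hv : ∀ i ∈ I, v (.inl i) = 0 ∧ v (.inr i) = 0) : g.1 *ᵥ v = v := by
  induction hg using Subgroup.closure_induction with
  | mem g hg =>
    obtain ⟨S, hS, hI, rfl | rfl⟩ := hg
    · have h0 : ∀ i j, S i j * v (.inr j) = 0 := fun i j => by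
        by_cases h : S i j = 0
        · rw [h, zero_mul]
        · rw [(hv j (hI i j h).2).2, mul_zero]
      funext k
      rcases k with i | i
      · simp [spUpper_mulVec_inl, h0]
      · simp [spUpper_mulVec_inr]
    · have h0 : ∀ i j, S i j * v (.inl j) = 0 := fun i j => by
        by_cases h : S i j = 0
        · rw [h, zero_mul]
        · rw [(hv j (hI i j h).2).1, mul_zero]
      funext k
      rcases k with i | i
      · simp [spLower_mulVec_inl]
      · simp [spLower_mulVec_inr, h0]
  | one => simp
  | mul g h _ _ hg hh => rw [mul_mulVec, hh, hg]
  | inv g _ hg =>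
    conv_lhs => rw [← hg]
    exact inv_mulVec_mulVec g v

/-! ### Reduction of integral vectors by descent on the ℓ¹ norm. -/

/-- `v'` lies in the orbit of `v` under `spSub I`. -/
def SpReach (I : Finset (Fin 3)) (v v' : Fin 3 ⊕ Fin 3 → ℤ) : Prop :=
  ∃ g ∈ spSub I, v' = g.1 *ᵥ v

theorem SpReach.refl (I : Finset (Fin 3)) (v : Fin 3 ⊕ Fin 3 → ℤ) : SpReach I v v :=
  ⟨1, one_mem _, by simp⟩

theorem SpReach.trans {I : Finset (Fin 3)} {v v' v'' : Fin 3 ⊕ Fin 3 → ℤ} (h : SpReach I v v')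
    (h' : SpReach I v' v'') : SpReach I v v'' := by
  obtain ⟨g, hg, rfl⟩ := h
  obtain ⟨g', hg', rfl⟩ := h'
  exact ⟨g' * g, mul_mem hg' hg, (mul_mulVec _ _ _).symm⟩

/-- The symmetric matrix with entry `t` at `(i, j)` and `(j, i)`. -/
def symmSingle (i j : Fin 3) (t : ℤ) : Matrix (Fin 3) (Fin 3) ℤ :=
  Matrix.of fun a b => if (a = i ∧ b = j) ∨ (a = j ∧ b = i) then t else 0

theorem symmSingle_isSymm (i j : Fin 3) (t : ℤ) : (symmSingle i j t).IsSymm := by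
  ext a b
  simp only [symmSingle, transpose_apply, of_apply]
  congr 1
  exact propext ⟨fun h => h.elim (fun h => .inr ⟨h.2, h.1⟩) (fun h => .inl ⟨h.2, h.1⟩),
    fun h => h.elim (fun h => .inr ⟨h.2, h.1⟩) (fun h => .inl ⟨h.2, h.1⟩)⟩

theorem symmSingle_supported {I : Finset (Fin 3)} {i j : Fin 3} (hi : i ∈ I) (hj : j ∈ I) (t : ℤ)
    (a b : Fin 3) (h : symmSingle i j t a b ≠ 0) : a ∈ I ∧ b ∈ I := by
  simp only [symmSingle, of_apply, ne_eq, ite_eq_right_iff, not_forall] at h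
  obtain ⟨h | h, -⟩ := h <;> rw [h.1, h.2]
  · exact ⟨hi, hj⟩
  · exact ⟨hj, hi⟩

/-- For i ≠ j the mirror entry at (j, i) would also produce t q_i in place j; the condition `hij`
removes this side effect, so that a single coordinate changes. -/
theorem sum_symmSingle_mul {i j : Fin 3} (t : ℤ) {q : Fin 3 → ℤ} (hij : i ≠ j → q i = 0)
    (k : Fin 3) : ∑ l, symmSingle i j t k l * q l = if k = i then t * q j else 0 := by
  fin_cases i <;> fin_cases j <;> fin_cases k <;>
    simp_all [symmSingle]

theorem spReach_upper {I : Finset (Fin 3)} {i j : Fin 3} (hi : i ∈ I) (hj : j ∈ I) (t : ℤ)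
    {v : Fin 3 ⊕ Fin 3 → ℤ} (hij : i ≠ j → v (.inr i) = 0) :
    SpReach I v (Function.update v (.inl i) (v (.inl i) + t * v (.inr j))) := by
  refine ⟨spUpper (symmSingle i j t) (symmSingle_isSymm i j t), Subgroup.subset_closure
    ⟨_, symmSingle_isSymm i j t, symmSingle_supported hi hj t, .inl rfl⟩, ?_⟩
  funext k
  rcases k with k | k
  · rw [spUpper_mulVec_inl, sum_symmSingle_mul t (q := fun l => v (.inr l)) hij]
    by_cases h : k = i
    · subst h; simp
    · simp [h]
  · rw [spUpper_mulVec_inr]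
    simp

theorem spReach_lower {I : Finset (Fin 3)} {i j : Fin 3} (hi : i ∈ I) (hj : j ∈ I) (t : ℤ)
    {v : Fin 3 ⊕ Fin 3 → ℤ} (hij : i ≠ j → v (.inl i) = 0) :
    SpReach I v (Function.update v (.inr i) (v (.inr i) + t * v (.inl j))) := by
  refine ⟨spLower (symmSingle i j t) (symmSingle_isSymm i j t), Subgroup.subset_closure
    ⟨_, symmSingle_isSymm i j t, symmSingle_supported hi hj t, .inr rfl⟩, ?_⟩
  funext k
  rcases k with k | k
  · rw [spLower_mulVec_inl]
    simp
  · rw [spLower_mulVec_inr, sum_symmSingle_mul t (q := fun l => v (.inl l)) hij]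
    by_cases h : k = i
    · subst h; simp
    · simp [h]

theorem spReach_rotate {I : Finset (Fin 3)} {i : Fin 3} (hi : i ∈ I) (v : Fin 3 ⊕ Fin 3 → ℤ) :
    SpReach I v (Function.update (Function.update v (.inl i) (-v (.inr i))) (.inr i)
      (v (.inl i))) := by
  -- On the pair (p, q): (p, q) ↦ (p - q, q) ↦ (p - q, p) ↦ (-q, p).
  have h₁ := spReach_upper hi hi (-1) (v := v) (fun h => absurd rfl h)
  have h₂ := h₁.trans (spReach_lower hi hi 1 (fun h => absurd rfl h))
  have h₃ := h₂.trans (spReach_upper hi hi (-1) (fun h => absurd rfl h))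
  convert h₃ using 1
  funext k
  rcases k with k | k <;> by_cases h : k = i
  · subst h; simp
  · simp [h]
  · subst h; simp
  · simp [h]

/-- The `ℓ¹` norm. -/
def spNorm (v : Fin 3 ⊕ Fin 3 → ℤ) : ℕ := ∑ k, (v k).natAbs

theorem spNorm_update_lt {v : Fin 3 ⊕ Fin 3 → ℤ} {k : Fin 3 ⊕ Fin 3} {x : ℤ}
    (h : x.natAbs < (v k).natAbs) : spNorm (Function.update v k x) < spNorm v := by
  refine Finset.sum_lt_sum (fun l _ => ?_) ⟨k, Finset.mem_univ k, by simpa using h⟩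
  by_cases hl : l = k
  · subst hl
    simpa using h.le
  · simp [hl]

theorem spNorm_rotate (v : Fin 3 ⊕ Fin 3 → ℤ) (i : Fin 3) :
    spNorm (Function.update (Function.update v (.inl i) (-v (.inr i))) (.inr i) (v (.inl i)))
      = spNorm v := by
  fin_cases i <;> simp [spNorm, Fin.sum_univ_three, Function.update_apply] <;> ring

theorem exists_natAbs_add_mul_lt {a b : ℤ} (hb : b ≠ 0) (h : b.natAbs ≤ a.natAbs) :
    ∃ t : ℤ, (a + t * b).natAbs < a.natAbs := by
  rcases le_total 0 a with ha | ha <;> rcases le_total 0 b with hb' | hb'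
  · exact ⟨-1, by omega⟩
  · exact ⟨1, by omega⟩
  · exact ⟨1, by omega⟩
  · exact ⟨-1, by omega⟩

/-- If both coordinates were nonzero, adding a multiple of the smaller to the larger would lower the
norm. -/
theorem spMin_inl_inr {I : Finset (Fin 3)} {v : Fin 3 ⊕ Fin 3 → ℤ}
    (hmin : ∀ v', SpReach I v v' → spNorm v ≤ spNorm v') {i j : Fin 3} (hi : i ∈ I) (hj : j ∈ I)
    (hij : i ≠ j → v (.inr i) = 0 ∧ v (.inl j) = 0) : v (.inl i) = 0 ∨ v (.inr j) = 0 := by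
  by_contra! h
  rcases le_total (v (.inr j)).natAbs (v (.inl i)).natAbs with hle | hle
  · obtain ⟨t, ht⟩ := exists_natAbs_add_mul_lt h.2 hle
    exact (spNorm_update_lt ht).not_ge (hmin _ (spReach_upper hi hj t fun h => (hij h).1))
  · obtain ⟨t, ht⟩ := exists_natAbs_add_mul_lt h.1 hle
    exact (spNorm_update_lt ht).not_ge
      (hmin _ (spReach_lower hj hi t fun h => (hij h.symm).2))

theorem spMin_rotate {I : Finset (Fin 3)} {v : Fin 3 ⊕ Fin 3 → ℤ}
    (hmin : ∀ v', SpReach I v v' → spNorm v ≤ spNorm v') {i : Fin 3} (hi : i ∈ I) :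
    ∀ v', SpReach I (Function.update (Function.update v (.inl i) (-v (.inr i))) (.inr i)
      (v (.inl i))) v' →
      spNorm (Function.update (Function.update v (.inl i) (-v (.inr i))) (.inr i) (v (.inl i)))
        ≤ spNorm v' := by
  intro v' h
  rw [spNorm_rotate]
  exact hmin v' ((spReach_rotate hi v).trans h)

theorem spMin_unique {I : Finset (Fin 3)} {v : Fin 3 ⊕ Fin 3 → ℤ}
    (hmin : ∀ v', SpReach I v v' → spNorm v ≤ spNorm v') {i j : Fin 3} (hi : i ∈ I) (hj : j ∈ I)
    (hij : i ≠ j) (h : v (.inl i) ≠ 0 ∨ v (.inr i) ≠ 0) : v (.inl j) = 0 ∧ v (.inr j) = 0 := by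
  have self : ∀ {v}, (∀ v', SpReach I v v' → spNorm v ≤ spNorm v') → ∀ {i}, i ∈ I →
      v (.inl i) = 0 ∨ v (.inr i) = 0 :=
    fun hmin _ hi => spMin_inl_inr hmin hi hi fun h => absurd rfl h
  have key : ∀ {v}, (∀ v', SpReach I v v' → spNorm v ≤ spNorm v') →
      v (.inl i) = 0 ∨ v (.inr j) = 0 := by
    intro v hmin
    by_contra! h
    refine (spMin_inl_inr hmin hi hj fun _ => ⟨?_, ?_⟩).elim h.1 h.2
    · exact (self hmin hi).resolve_left h.1
    · exact (self hmin hj).resolve_right h.2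
  -- A rotation at an index exchanges its two coordinates up to sign and keeps minimality. Applying
  -- `key` after rotating at i, at j, or at both shows that each coordinate at i has zero product
  -- with each coordinate at j.
  have hi' := key (spMin_rotate hmin hi)
  have hj' := key (spMin_rotate hmin hj)
  have hij' := key (spMin_rotate (spMin_rotate hmin hi) hj)
  have h₀ := key hmin
  simp [hij, hij.symm] at hi' hj' hij'
  tauto

theorem spReach_normalForm {I : Finset (Fin 3)} {i₀ : Fin 3} (h₀ : i₀ ∈ I)
    (v : Fin 3 ⊕ Fin 3 → ℤ) : ∃ v', SpReach I v v' ∧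
      ∀ i ∈ I, v' (.inr i) = 0 ∧ (i ≠ i₀ → v' (.inl i) = 0) := by
  obtain ⟨v', hv', hmin'⟩ : ∃ v', SpReach I v v' ∧ ∀ w, SpReach I v w → spNorm v' ≤ spNorm w := by
    have hex : ∃ n, ∃ w, SpReach I v w ∧ spNorm w = n := ⟨_, v, .refl I v, rfl⟩
    classical
    obtain ⟨w, hw, hn⟩ := Nat.find_spec hex
    exact ⟨w, hw, fun w' hw' => hn ▸ Nat.find_min' hex ⟨w', hw', rfl⟩⟩
  have hmin : ∀ w, SpReach I v' w → spNorm v' ≤ spNorm w := fun w hw => hmin' w (hv'.trans hw)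
  have rot : ∀ i ∈ I, ∀ w : Fin 3 ⊕ Fin 3 → ℤ, w (.inl i) = 0 → SpReach I w
      (Function.update (Function.update w (.inl i) (-w (.inr i))) (.inr i) 0) := by
    intro i hi w hw
    have := spReach_rotate hi w
    rwa [hw] at this
  obtain ⟨w, hw, i, hi, hwi, hwI⟩ : ∃ w, SpReach I v w ∧ ∃ i ∈ I, w (.inr i) = 0 ∧
      ∀ j ∈ I, j ≠ i → w (.inl j) = 0 ∧ w (.inr j) = 0 := by
    by_cases hz : ∃ i ∈ I, v' (.inl i) ≠ 0 ∨ v' (.inr i) ≠ 0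
    · obtain ⟨i, hi, hne⟩ := hz
      have hI := fun j hj (hij : j ≠ i) => spMin_unique hmin hi hj hij.symm hne
      rcases spMin_inl_inr hmin hi hi fun h => absurd rfl h with h | h
      · exact ⟨_, hv'.trans (rot i hi v' h), i, hi, by simp, fun j hj hij => by
          simpa [hij] using hI j hj hij⟩
      · exact ⟨v', hv', i, hi, h, hI⟩
    · push Not at hz
      exact ⟨v', hv', i₀, h₀, (hz i₀ h₀).2, fun j hj _ => hz j hj⟩
  by_cases hii : i = i₀
  · subst hii
    refine ⟨w, hw, fun j hj => ?_⟩
    by_cases hj' : j = i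
    · subst hj'; exact ⟨hwi, fun h => absurd rfl h⟩
    · exact ⟨(hwI j hj hj').2, fun _ => (hwI j hj hj').1⟩
  -- The surviving entry moves from i to i₀: it is copied to the lower coordinate at i₀, subtracted
  -- from its old place, and rotated into the upper coordinate.
  have hw₀ := hwI i₀ h₀ (Ne.symm hii)
  have r₁ := spReach_lower h₀ hi 1 (v := w) fun _ => hw₀.1
  have r₂ := r₁.trans (spReach_upper hi h₀ (-1) fun h => by simpa [hii] using hwi)
  have r₃ := r₂.trans (rot i₀ h₀ _ (by simp [hw₀.1, Ne.symm hii]))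
  refine ⟨_, hw.trans r₃, fun j hj => ?_⟩
  by_cases hj₀ : j = i₀
  · subst hj₀; simp
  · by_cases hji : j = i
    · subst hji; simp [hj₀, hwi, hw₀.2]
    · simp [hj₀, hji, hwI j hj hji]

/-! ### Block triangular form of integral symplectic matrices. -/

/-- The first three columns are cleared in turn with the index sets {0, 1, 2}, {1, 2}, {2}. The
entries of C above its diagonal, which this leaves, vanish by the symplectic relations. -/
theorem exists_spSub_mul_blockTriangular (δ : symplecticGroup (Fin 3) ℤ) :
    ∃ g ∈ spSub Finset.univ, (g * δ).1.toBlocks₂₁ = 0 ∧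
      (g * δ).1 (.inl 1) (.inl 0) = 0 ∧ (g * δ).1 (.inl 2) (.inl 0) = 0 ∧
      (g * δ).1 (.inl 2) (.inl 1) = 0 := by
  have col : ∀ (g h : symplecticGroup (Fin 3) ℤ) (k : Fin 3 ⊕ Fin 3),
      (g * h).1.col k = g.1 *ᵥ h.1.col k := by
    intro g h k
    funext l
    rfl
  have sub : ∀ I, spSub I ≤ spSub Finset.univ := fun I =>
    Subgroup.closure_mono fun g ⟨S, hS, _, hg⟩ => ⟨S, hS, fun _ _ _ => by simp, hg⟩
  have rel : ∀ h : symplecticGroup (Fin 3) ℤ, ∀ i j,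
      ∑ k, h.1 (.inl k) (.inl i) * h.1 (.inr k) (.inl j)
        = ∑ k, h.1 (.inr k) (.inl i) * h.1 (.inl k) (.inl j) := by
    intro h i j
    have h₁ := h.2
    rw [← fromBlocks_toBlocks h.1, SymplecticGroup.fromBlocks_mem_iff] at h₁
    exact congrFun (congrFun h₁.1 i) j
  have rel' : ∀ h : symplecticGroup (Fin 3) ℤ, ∀ i j,
      ∑ k, h.1 (.inl k) (.inl i) * h.1 (.inr k) (.inr j)
        - ∑ k, h.1 (.inr k) (.inl i) * h.1 (.inl k) (.inr j)
        = (1 : Matrix (Fin 3) (Fin 3) ℤ) i j := by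
    intro h i j
    have h₁ := h.2
    rw [← fromBlocks_toBlocks h.1, SymplecticGroup.fromBlocks_mem_iff] at h₁
    exact congrFun (congrFun h₁.2.2 i) j
  obtain ⟨_, ⟨g₀, hg₀, rfl⟩, h₀⟩ := spReach_normalForm (Finset.mem_univ (0 : Fin 3)) (δ.1.col (.inl 0))
  rw [← col] at h₀
  obtain ⟨δ₀, e₀⟩ : ∃ δ₀, δ₀ = g₀ * δ := ⟨_, rfl⟩
  rw [← e₀] at h₀
  obtain ⟨_, ⟨g₁, hg₁, rfl⟩, h₁⟩ :=
    spReach_normalForm (I := {1, 2}) (i₀ := 1) (by simp) (δ₀.1.col (.inl 1))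
  rw [← col] at h₁
  have c₁ : (g₁ * δ₀).1.col (.inl 0) = δ₀.1.col (.inl 0) := by
    rw [col]
    refine spSub_mulVec_eq_self hg₁ fun i hi => ⟨(h₀ i (Finset.mem_univ _)).2 ?_,
      (h₀ i (Finset.mem_univ _)).1⟩
    rintro rfl
    simp at hi
  rw [← c₁] at h₀
  obtain ⟨δ₁, e₁⟩ : ∃ δ₁, δ₁ = g₁ * δ₀ := ⟨_, rfl⟩
  rw [← e₁] at h₀ h₁
  obtain ⟨_, ⟨g₂, hg₂, rfl⟩, h₂⟩ :=
    spReach_normalForm (I := {2}) (i₀ := 2) (by simp) (δ₁.1.col (.inl 2))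
  rw [← col] at h₂
  have c₂ : (g₂ * δ₁).1.col (.inl 0) = δ₁.1.col (.inl 0) := by
    rw [col]
    refine spSub_mulVec_eq_self hg₂ fun i hi => ⟨(h₀ i (Finset.mem_univ _)).2 ?_,
      (h₀ i (Finset.mem_univ _)).1⟩
    rintro rfl
    simp at hi
  have c₃ : (g₂ * δ₁).1.col (.inl 1) = δ₁.1.col (.inl 1) := by
    rw [col]
    refine spSub_mulVec_eq_self hg₂ fun i hi => ?_
    have hi' := Finset.mem_singleton.mp hi
    subst hi'
    exact ⟨(h₁ 2 (by simp)).2 (by simp), (h₁ 2 (by simp)).1⟩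
  rw [← c₂] at h₀
  rw [← c₃] at h₁
  obtain ⟨δ₂, e₂⟩ : ∃ δ₂, δ₂ = g₂ * δ₁ := ⟨_, rfl⟩
  rw [← e₂] at h₀ h₁ h₂
  have e : δ₂ = g₂ * g₁ * g₀ * δ := by rw [e₂, e₁, e₀, mul_assoc, mul_assoc]
  refine ⟨g₂ * g₁ * g₀, mul_mem (mul_mem (sub _ hg₂) (sub _ hg₁)) hg₀, ?_⟩
  rw [← e]
  have a₀₀ := (h₀ 0 (by simp)).1
  have a₀₁ := (h₀ 1 (by simp)).1
  have a₀₂ := (h₀ 2 (by simp)).1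
  have b₀₁ := (h₀ 1 (by simp)).2 (by simp)
  have b₀₂ := (h₀ 2 (by simp)).2 (by simp)
  have a₁₁ := (h₁ 1 (by simp)).1
  have a₁₂ := (h₁ 2 (by simp)).1
  have b₁₂ := (h₁ 2 (by simp)).2 (by simp)
  have a₂₂ := (h₂ 2 (by simp)).1
  simp only [col_apply] at a₀₀ a₀₁ a₀₂ b₀₁ b₀₂ a₁₁ a₁₂ b₁₂ a₂₂
  -- AᵀD - CᵀB = 1 forces the first two diagonal entries of A to be nonzero; the symmetry of AᵀC
  -- then kills the entries (0, 1), (0, 2) and (1, 2) of C.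
  have r₀ := rel' δ₂ 0 0
  have r₀' := rel' δ₂ 0 1
  have r₁ := rel' δ₂ 1 1
  rw [one_apply_eq] at r₀ r₁
  rw [one_apply_ne (by decide)] at r₀'
  have r₀₁ := rel δ₂ 0 1
  have r₀₂ := rel δ₂ 0 2
  have r₁₂ := rel δ₂ 1 2
  simp only [Fin.sum_univ_three, a₀₀, a₀₁, a₀₂, b₀₁, b₀₂, a₁₁, a₁₂, b₁₂, a₂₂, zero_mul, mul_zero,
    add_zero, sub_zero, mul_eq_zero] at r₀ r₀' r₁ r₀₁ r₀₂ r₁₂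
  have n₀ : δ₂.1 (.inl 0) (.inl 0) ≠ 0 := fun h => by simp [h] at r₀
  have a₁₀ := r₀₁.resolve_left n₀
  have a₂₀ := r₀₂.resolve_left n₀
  rw [a₁₀, zero_mul, sub_zero, r₀'.resolve_left n₀, mul_zero, zero_add] at r₁
  have n₁ : δ₂.1 (.inl 1) (.inl 1) ≠ 0 := fun h => by simp [h] at r₁
  rw [a₂₀, a₁₀, mul_zero, zero_add, zero_mul, mul_eq_zero] at r₁₂
  have a₂₁ := r₁₂.resolve_left n₁
  refine ⟨?_, b₀₁, b₀₂, b₁₂⟩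
  ext i j
  fin_cases i <;> fin_cases j <;> assumption

theorem spUpper_eq_spTranslate {S : Matrix (Fin 3) (Fin 3) ℤ} (hS : S.IsSymm) :
    spUpper S hS = spTranslate ![S 0 0, S 1 1, S 2 2] ![S 0 1, S 0 2, S 1 2] := by
  refine Subtype.ext ?_
  simp only [spUpper, spTranslate]
  congr 1
  ext i j
  fin_cases i <;> fin_cases j <;> simp [symmMatrix, hS.apply 0 1, hS.apply 0 2, hS.apply 1 2]

/-- The block diagonal symplectic matrix `(A, 0; 0, D)` with `Aᵀ D = 1`. -/
def spDiag (A D : Matrix (Fin 3) (Fin 3) ℤ) (h : Aᵀ * D = 1) : symplecticGroup (Fin 3) ℤ :=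
  ⟨fromBlocks A 0 0 D, by simp [SymplecticGroup.fromBlocks_mem_iff, h]⟩

/-! ### Generation of Sp_6(ℤ) by J and translations. -/

section Generation

variable {K : Subgroup (symplecticGroup (Fin 3) ℤ)} (hJ : SymplecticGroup.symJ (Fin 3) ℤ ∈ K)
  (hT : ∀ s u, spTranslate s u ∈ K)

include hT in
theorem spUpper_mem {S : Matrix (Fin 3) (Fin 3) ℤ} (hS : S.IsSymm) : spUpper S hS ∈ K := by
  rw [spUpper_eq_spTranslate]
  exact hT _ _

include hJ hT in
theorem spLower_mem {S : Matrix (Fin 3) (Fin 3) ℤ} (hS : S.IsSymm) : spLower S hS ∈ K := by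
  have hS' : (-S).IsSymm := by rw [Matrix.IsSymm, transpose_neg, hS.eq]
  have h : SymplecticGroup.symJ (Fin 3) ℤ * spLower S hS
      = spUpper (-S) hS' * SymplecticGroup.symJ (Fin 3) ℤ := by
    refine Subtype.ext ?_
    change J (Fin 3) ℤ * fromBlocks 1 0 S 1 = fromBlocks 1 (-S) 0 1 * J (Fin 3) ℤ
    rw [J, fromBlocks_multiply, fromBlocks_multiply]
    simp
  exact (Subgroup.mul_mem_cancel_left _ hJ).mp (h ▸ mul_mem (spUpper_mem hT hS') hJ)

include hJ hT in
-- For symmetric S with inverse S', (S, 0; 0, S') = (1, S; 0, 1)(1, 0; -S', 1)(1, S; 0, 1)J.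
theorem spDiag_mem_of_isSymm {S S' : Matrix (Fin 3) (Fin 3) ℤ} (hS : S.IsSymm) (hS' : S'.IsSymm)
    (h : Sᵀ * S' = 1) : spDiag S S' h ∈ K := by
  have hn : (-S').IsSymm := by rw [Matrix.IsSymm, transpose_neg, hS'.eq]
  have h₁ : S * S' = 1 := by rwa [hS.eq] at h
  have h₂ : S' * S = 1 := mul_eq_one_comm.mp h₁
  have e : spDiag S S' h = spUpper S hS * spLower (-S') hn * spUpper S hS
      * SymplecticGroup.symJ (Fin 3) ℤ := by
    refine Subtype.ext ?_
    change fromBlocks S 0 0 S' = fromBlocks 1 S 0 1 * fromBlocks 1 0 (-S') 1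
      * fromBlocks 1 S 0 1 * J (Fin 3) ℤ
    rw [J, fromBlocks_multiply, fromBlocks_multiply, fromBlocks_multiply]
    simp [h₁, h₂]
  rw [e]
  exact mul_mem (mul_mem (mul_mem (spUpper_mem hT hS) (spLower_mem hJ hT hn)) (spUpper_mem hT hS))
    hJ

include hJ hT in
-- Peels a symmetric factor off the left, so that any product of symmetric unimodular matrices can
-- be treated.
theorem spDiag_mem_mul {S S' A D : Matrix (Fin 3) (Fin 3) ℤ} (hS : S.IsSymm) (hS' : S'.IsSymm)
    (h : S * S' = 1) (hA : ∀ D (h : Aᵀ * D = 1), spDiag A D h ∈ K) (hD : (S * A)ᵀ * D = 1) :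
    spDiag (S * A) D hD ∈ K := by
  have h₁ : Sᵀ * S' = 1 := by rwa [hS.eq]
  have h₂ : Aᵀ * (S * D) = 1 := by rw [← Matrix.mul_assoc, ← hD, transpose_mul, hS.eq]
  have h₃ : D = S' * (S * D) := by
    rw [← Matrix.mul_assoc, mul_eq_one_comm.mp h, Matrix.one_mul]
  have e : spDiag (S * A) D hD = spDiag S S' h₁ * spDiag A (S * D) h₂ := by
    refine Subtype.ext ?_
    change fromBlocks (S * A) 0 0 D = fromBlocks S 0 0 S' * fromBlocks A 0 0 (S * D)
    rw [fromBlocks_multiply, ← h₃]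
    simp
  rw [e]
  exact mul_mem (spDiag_mem_of_isSymm hJ hT hS hS' h₁) (hA _ _)

include hJ hT in
theorem spDiag_mem {a d f : ℤ} (ha : a * a = 1) (hd : d * d = 1) (hf : f * f = 1) (x y z : ℤ)
    (D : Matrix (Fin 3) (Fin 3) ℤ) (h : !![a, x, y; 0, d, z; 0, 0, f]ᵀ * D = 1) :
    spDiag !![a, x, y; 0, d, z; 0, 0, f] D h ∈ K := by
  -- After the sign matrix the symmetric factors come in pairs, (0, 1; 1, 0)(0, 1; 1, t) = (1, t; 0,
  -- 1) in two of the coordinates, each pair a transvection. The parameters d z, a y, a x compensate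
  -- the signs, as a² = d² = 1.
  have e : !![a, x, y; 0, d, z; 0, 0, f] = !![a, 0, 0; 0, d, 0; 0, 0, f]
      * (!![1, 0, 0; 0, 0, 1; 0, 1, 0] * (!![1, 0, 0; 0, 0, 1; 0, 1, d * z]
      * (!![0, 0, 1; 0, 1, 0; 1, 0, 0] * (!![0, 0, 1; 0, 1, 0; 1, 0, a * y]
      * (!![0, 1, 0; 1, 0, 0; 0, 0, 1] * (!![0, 1, 0; 1, a * x, 0; 0, 0, 1] * 1)))))) := by
    ext i j
    fin_cases i <;> fin_cases j <;>
      simp [Matrix.mul_apply, Fin.sum_univ_three, ← mul_assoc, ha, hd]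
  have one : ∀ D (h : (1 : Matrix (Fin 3) (Fin 3) ℤ)ᵀ * D = 1), spDiag 1 D h ∈ K := by
    intro D h
    have : spDiag 1 D h = 1 := by
      refine Subtype.ext ?_
      have hD : D = 1 := by simpa using h
      subst hD
      exact fromBlocks_one
    rw [this]
    exact one_mem K
  have symm : ∀ a b c d e f : ℤ, (!![a, b, c; b, d, e; c, e, f]).IsSymm := by
    intro a b c d e f
    ext i j
    fin_cases i <;> fin_cases j <;> rfl
  generalize !![a, x, y; 0, d, z; 0, 0, f] = A at e h ⊢
  subst e
  refine spDiag_mem_mul hJ hT (S' := !![a, 0, 0; 0, d, 0; 0, 0, f]) (symm _ _ _ _ _ _)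
    (symm _ _ _ _ _ _) ?_ (fun D h => ?_) h
  · ext i j
    fin_cases i <;> fin_cases j <;> simp [Matrix.mul_apply, Fin.sum_univ_three, ha, hd, hf]
  refine spDiag_mem_mul hJ hT (S' := !![1, 0, 0; 0, 0, 1; 0, 1, 0]) (symm _ _ _ _ _ _)
    (symm _ _ _ _ _ _) (by decide) (fun D h => ?_) h
  refine spDiag_mem_mul hJ hT (S' := !![1, 0, 0; 0, -(d * z), 1; 0, 1, 0]) (symm _ _ _ _ _ _)
    (symm _ _ _ _ _ _) ?_ (fun D h => ?_) h
  · ext i j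
    fin_cases i <;> fin_cases j <;> simp [Matrix.mul_apply, Fin.sum_univ_three]
  refine spDiag_mem_mul hJ hT (S' := !![0, 0, 1; 0, 1, 0; 1, 0, 0]) (symm _ _ _ _ _ _)
    (symm _ _ _ _ _ _) (by decide) (fun D h => ?_) h
  refine spDiag_mem_mul hJ hT (S' := !![-(a * y), 0, 1; 0, 1, 0; 1, 0, 0]) (symm _ _ _ _ _ _)
    (symm _ _ _ _ _ _) ?_ (fun D h => ?_) h
  · ext i j
    fin_cases i <;> fin_cases j <;> simp [Matrix.mul_apply, Fin.sum_univ_three]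
  refine spDiag_mem_mul hJ hT (S' := !![0, 1, 0; 1, 0, 0; 0, 0, 1]) (symm _ _ _ _ _ _)
    (symm _ _ _ _ _ _) (by decide) (fun D h => ?_) h
  refine spDiag_mem_mul hJ hT (S' := !![-(a * x), 1, 0; 1, 0, 0; 0, 0, 1]) (symm _ _ _ _ _ _)
    (symm _ _ _ _ _ _) ?_ one h
  · ext i j
    fin_cases i <;> fin_cases j <;> simp [Matrix.mul_apply, Fin.sum_univ_three]

include hJ hT in
/-- `Sp_6(ℤ)` is generated by `J` and the translations. -/
theorem eq_top_of_symJ_mem_of_spTranslate_mem : K = ⊤ := by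
  refine eq_top_iff.mpr fun δ _ => ?_
  obtain ⟨g, hg, hC, h₁₀, h₂₀, h₂₁⟩ := exists_spSub_mul_blockTriangular δ
  have hgK : spSub Finset.univ ≤ K := by
    refine (Subgroup.closure_le K).mpr ?_
    rintro _ ⟨S, hS, -, rfl | rfl⟩
    · exact spUpper_mem hT hS
    · exact spLower_mem hJ hT hS
  refine (Subgroup.mul_mem_cancel_left _ (hgK hg)).mp ?_
  generalize g * δ = M at hC h₁₀ h₂₀ h₂₁
  obtain ⟨A, hAdef⟩ : ∃ A, A = M.1.toBlocks₁₁ := ⟨_, rfl⟩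
  obtain ⟨B, hBdef⟩ : ∃ B, B = M.1.toBlocks₁₂ := ⟨_, rfl⟩
  obtain ⟨D, hDdef⟩ : ∃ D, D = M.1.toBlocks₂₂ := ⟨_, rfl⟩
  have hM : M.1 = fromBlocks A B 0 D := by
    rw [hAdef, hBdef, hDdef, ← hC, fromBlocks_toBlocks]
  have hMem := M.2
  rw [hM, SymplecticGroup.fromBlocks_mem_iff] at hMem
  obtain ⟨-, hBD, hAD⟩ := hMem
  rw [transpose_zero, Matrix.zero_mul, sub_zero] at hAD
  have hA : A = !![A 0 0, A 0 1, A 0 2; 0, A 1 1, A 1 2; 0, 0, A 2 2] := by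
    have h₁ : A 1 0 = 0 := by rw [hAdef]; exact h₁₀
    have h₂ : A 2 0 = 0 := by rw [hAdef]; exact h₂₀
    have h₃ : A 2 1 = 0 := by rw [hAdef]; exact h₂₁
    ext i j
    fin_cases i <;> fin_cases j <;> simp [h₁, h₂, h₃]
  have hdet : IsUnit (A 0 0 * A 1 1 * A 2 2) := by
    have : IsUnit A.det := by
      have h := congrArg Matrix.det hAD
      rw [Matrix.det_mul, Matrix.det_transpose, Matrix.det_one] at h
      exact IsUnit.of_mul_eq_one _ h
    rw [hA, Matrix.det_fin_three] at this
    simpa using this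
  have hu := IsUnit.mul_iff.mp hdet
  have hu' := IsUnit.mul_iff.mp hu.1
  have sq : ∀ {a : ℤ}, IsUnit a → a * a = 1 := fun h => Int.isUnit_mul_self h
  have hdiag : ∀ D (h : Aᵀ * D = 1), spDiag A D h ∈ K := by
    rw [hA]
    exact spDiag_mem hJ hT (sq hu'.1) (sq hu'.2) (sq hu.2) _ _ _
  have hDA : D * Aᵀ = 1 := mul_eq_one_comm.mp hAD
  have hADt : A * Dᵀ = 1 := by
    have := congrArg Matrix.transpose hDA
    rwa [transpose_mul, transpose_transpose, transpose_one] at this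
  -- Dᵀ is the inverse of A, so this is the translation part A⁻¹B.
  have hS : (Dᵀ * B).IsSymm := by
    rw [Matrix.IsSymm, transpose_mul, transpose_transpose, hBD]
  have e : M = spDiag A D hAD * spUpper (Dᵀ * B) hS := by
    refine Subtype.ext ?_
    change M.1 = fromBlocks A 0 0 D * fromBlocks 1 (Dᵀ * B) 0 1
    rw [hM, fromBlocks_multiply, ← Matrix.mul_assoc, hADt]
    simp
  rw [e]
  exact mul_mem (hdiag D hAD) (spUpper_mem hT hS)

end Generation

/-! ### The lift of `Sp_6(ℤ)` -/

/-- The inclusion of `Sp_6(ℤ)` in `Sp_6(ℝ)`. -/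
def spIntCast : symplecticGroup (Fin 3) ℤ →* SpR where
  toFun δ := ⟨δ.1.map (Int.castRingHom ℝ), SymplecticGroup.map_mem δ.2 _⟩
  map_one' := Subtype.ext (Matrix.map_one _ (map_zero _) (map_one _))
  map_mul' _ _ := Subtype.ext Matrix.map_mul

/-- The elements of Sp_6(ℤ) that have an integral partner form a subgroup, so it is enough to
exhibit partners for J and the translations. -/
theorem map_fst_compatible :
    (compatible ⊓ SpZ.prod E7Z).map (MonoidHom.fst SpR E7R) = SpZ := by
  refine le_antisymm ?_ ?_
  · rintro _ ⟨p, ⟨-, hp⟩, rfl⟩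
    exact hp.1
  have htop : ((compatible ⊓ SpZ.prod E7Z).map (MonoidHom.fst SpR E7R)).comap spIntCast = ⊤ := by
    refine eq_top_of_symJ_mem_of_spTranslate_mem ?_ fun s u => ?_
    · have h : spIntCast (SymplecticGroup.symJ (Fin 3) ℤ) = SymplecticGroup.symJ (Fin 3) ℝ :=
        Subtype.ext (Matrix.map_J _ _)
      refine ⟨(SymplecticGroup.symJ (Fin 3) ℝ, weylE7), ⟨weyl_compatible,
        ⟨SymplecticGroup.symJ (Fin 3) ℤ, ?_⟩, weylE7_mem⟩, h.symm⟩
      exact congrArg Subtype.val h.symm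
    · have h : spIntCast (spTranslate s u)
          = spTranslate (fun i => (s i : ℝ)) (fun i => (u i : ℝ)) := by
        refine Subtype.ext ?_
        change (fromBlocks 1 (symmMatrix s u) 0 1).map (Int.castRingHom ℝ) = fromBlocks _ _ _ _
        rw [fromBlocks_map, Matrix.map_one _ (map_zero _) (map_one _),
          Matrix.map_zero _ (map_zero _)]
        congr 1
        ext i j
        fin_cases i <;> fin_cases j <;> rfl
      refine ⟨(spTranslate (fun i => (s i : ℝ)) (fun i => (u i : ℝ)), translateE7 _ _),
        ⟨spTranslate_compatible _ _, ⟨spTranslate s u, ?_⟩, translateE7_mem s u⟩, h.symm⟩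
      exact congrArg Subtype.val h.symm
  rintro γ ⟨δ, hδ⟩
  have hγ : γ = spIntCast δ := Subtype.ext hδ
  rw [hγ]
  exact (eq_top_iff.mp htop) (Subgroup.mem_top δ)

/-- The second entries of integral pairs lie in E_{7,3}(ℤ), where Γ has finite relative index; so
the condition of lying in Γ cuts out a finite-index subgroup of the integral pairs, whose image has
finite index in Sp_6(ℤ). -/
theorem commensurable_map_fst {Γ : Subgroup E7R} (hΓ : Γ.Commensurable E7Z) :
    ((compatible ⊓ SpZ.prod E7Z ⊓ Γ.comap (MonoidHom.snd SpR E7R)).map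
      (MonoidHom.fst SpR E7R)).Commensurable SpZ := by
  set L := compatible ⊓ SpZ.prod E7Z with hL
  set L' := L ⊓ Γ.comap (MonoidHom.snd SpR E7R) with hL'
  have hle : L'.map (MonoidHom.fst SpR E7R) ≤ SpZ := by
    rw [← map_fst_compatible]
    exact Subgroup.map_mono inf_le_left
  refine ⟨?_, ?_⟩
  · rw [← map_fst_compatible, ← Subgroup.relIndex_comap]
    have h₁ : (Γ.comap (MonoidHom.snd SpR E7R)).relIndex L ≠ 0 := by
      rw [Subgroup.relIndex_comap]
      refine fun h => hΓ.1 (Subgroup.relIndex_eq_zero_of_le_right ?_ h)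
      rintro _ ⟨p, ⟨-, hp⟩, rfl⟩
      exact hp.2
    have h₂ : L'.relIndex L ≠ 0 := by
      rw [hL', inf_comm, Subgroup.inf_relIndex_right]
      exact h₁
    exact fun h => h₂ (Subgroup.relIndex_eq_zero_of_le_left (Subgroup.le_comap_map _ _) h)
  · rw [Subgroup.relIndex_eq_one.mpr hle]
    exact one_ne_zero

/-! ### Restriction to the Siegel half space -/

open scoped MatrixOrder ComplexOrder in
-- The positive square root. It supplies the witness required by the positive cones, which are
-- defined through squares.
theorem exists_isSymm_mul_self_eq {n : ℕ} {Y : Matrix (Fin n) (Fin n) ℝ} (hY : Y.PosDef) :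
    ∃ X : Matrix (Fin n) (Fin n) ℝ, X.IsSymm ∧ X.det ≠ 0 ∧ X * X = Y := by
  have h := CFC.sqrt_mul_sqrt_self Y hY.posSemidef.nonneg
  refine ⟨CFC.sqrt Y, (CFC.sqrt_nonneg Y).isSelfAdjoint, fun h0 => ?_, h⟩
  have := hY.det_pos
  rw [← h, Matrix.det_mul, h0, zero_mul] at this
  exact lt_irrefl _ this

theorem ofSymm_mem {Z : Matrix (Fin 3) (Fin 3) ℂ} (hZ : Z ∈ siegelHalfSpace 3) :
    ofSymm Z ∈ exceptionalDomain := by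
  obtain ⟨X, hX, hdet, hsq⟩ := exists_isSymm_mul_self_eq hZ.2
  have e : ∀ i j, (Z i j).im = ∑ k, X i k * X k j := fun i j =>
    (congrFun (congrFun hsq i) j).symm
  have h₁ := hX.apply 0 1
  have h₂ := hX.apply 0 2
  have h₃ := hX.apply 1 2
  refine ⟨(![X 0 0, X 1 1, X 2 2],
    ![Oct.scalar (X 0 1), Oct.scalar (X 0 2), Oct.scalar (X 1 2)]), ?_, ?_⟩
  · convert hdet using 1
    simp [Albert.det, Matrix.det_fin_three, Oct.scalar, Oct.normSq, Oct.mul, Oct.conj,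
      Oct.tr, Fin.sum_univ_eight, h₁, h₂, h₃]
    ring
  · refine Prod.ext (funext fun i => ?_) (funext fun i => funext fun j => ?_)
    · fin_cases i <;> simp [Albert.map, ofSymm, Albert.sq, e, Fin.sum_univ_three, Oct.scalar,
        Oct.normSq, Fin.sum_univ_eight, h₁, h₂, h₃] <;> ring
    · fin_cases i <;> fin_cases j <;> simp [Albert.map, ofSymm, Albert.sq, e, Fin.sum_univ_three,
        Oct.scalar, Oct.mul, Oct.conj, h₁, h₃] <;> ring

theorem mem_exceptionalDomain₂ {Z : Matrix (Fin 2) (Fin 2) ℂ} (hZ : Z ∈ siegelHalfSpace 2) :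
    (![Z 0 0, Z 1 1], Oct.scalar (Z 0 1)) ∈ exceptionalDomain₂ := by
  obtain ⟨X, hX, hdet, hsq⟩ := exists_isSymm_mul_self_eq hZ.2
  have e : ∀ i j, (Z i j).im = ∑ k, X i k * X k j := fun i j =>
    (congrFun (congrFun hsq i) j).symm
  have h₁ := hX.apply 0 1
  refine ⟨(![X 0 0, X 1 1], Oct.scalar (X 0 1)), ?_, ?_⟩
  · convert hdet using 1
    simp [Albert₂.det, Matrix.det_fin_two, Oct.scalar, Oct.normSq, Fin.sum_univ_eight, h₁]
    ring
  · refine Prod.ext (funext fun i => ?_) (funext fun j => ?_)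
    · fin_cases i <;> simp [Albert₂.sq, e, Oct.scalar, Oct.normSq, Fin.sum_univ_eight, h₁] <;> ring
    · fin_cases j <;> simp [Albert₂.sq, e, Oct.scalar]
      ring

theorem ofSymm_siegelBlock (Z : Matrix (Fin 2) (Fin 2) ℂ) (t : ℂ) :
    ofSymm (siegelBlock Z t) = Albert₂.block (![Z 0 0, Z 1 1], Oct.scalar (Z 0 1)) t := by
  have h0 : Oct.scalar (0 : ℂ) = 0 := by
    funext j
    fin_cases j <;> rfl
  simp [ofSymm, siegelBlock, Albert₂.block, h0]

/-- `ofSymm` as a linear map. -/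
def ofSymmLinear : Matrix (Fin 3) (Fin 3) ℂ →ₗ[ℂ] Albert ℂ where
  toFun := ofSymm
  map_add' Z Z' := by
    refine Prod.ext (funext fun i => ?_) (funext fun i => funext fun j => ?_)
    · fin_cases i <;> rfl
    · fin_cases i <;> fin_cases j <;> simp [ofSymm, Oct.scalar]
  map_smul' := ofSymm_smul

theorem differentiableOn_restrict {F : Albert ℂ → ℂ} (hF : DifferentiableOn ℂ F exceptionalDomain) :
    DifferentiableOn ℂ (restrict F) (siegelHalfSpace 3) := by
  -- The entrywise sup norm induces the product topology on matrices, so differentiability keeps its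
  -- meaning.
  let : NormedAddCommGroup (Matrix (Fin 3) (Fin 3) ℂ) := Matrix.normedAddCommGroup
  let : NormedSpace ℂ (Matrix (Fin 3) (Fin 3) ℂ) := Matrix.normedSpace
  have h := hF.comp (s := siegelHalfSpace 3)
    (LinearMap.toContinuousLinearMap ofSymmLinear).differentiable.differentiableOn
    (fun Z hZ => ofSymm_mem hZ)
  exact h

/-- A compatible pair has equal automorphy factors and equal actions on scalar symmetric matrices,
so one transformation law becomes the other. -/
theorem IsModularForm.restrict {Γ : Subgroup E7R} {k : ℤ} {F : Albert ℂ → ℂ}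
    (hF : IsModularForm Γ k F) {Δ : Subgroup SpR}
    (hΔ : ∀ γ ∈ Δ, ∃ g ∈ Γ, (γ, g) ∈ compatible) :
    IsSiegelModularForm Δ k (E7.restrict F) where
  holo := differentiableOn_restrict hF.holo
  slash γ hγ Z hZ := by
    obtain ⟨g, hg, h⟩ := hΔ γ hγ
    have h₁ := hF.slash g hg (ofSymm Z) (ofSymm_mem hZ)
    rwa [act_ofSymm h hZ, autFactor_ofSymm h hZ] at h₁

theorem IsModularForm.restrict_levelOne {k : ℤ} {F : Albert ℂ → ℂ} (hF : IsModularForm E7Z k F) :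
    IsSiegelModularForm SpZ k (E7.restrict F) := by
  refine hF.restrict fun γ hγ => ?_
  rw [← map_fst_compatible] at hγ
  obtain ⟨p, ⟨hp, -, hp'⟩, rfl⟩ := hγ
  exact ⟨p.2, hp', hp⟩

end E7

theorem mainTheorem3 (k : ℤ) (F : E7.Albert ℂ → ℂ) :
    (∀ Γ : Subgroup E7.E7R, Γ.Commensurable E7.E7Z → E7.IsModularForm Γ k F →
      ∃ Δ : Subgroup E7.SpR, Δ.Commensurable E7.SpZ ∧
        E7.IsSiegelModularForm Δ k (E7.restrict F)) ∧
    (E7.IsModularForm E7.E7Z k F → E7.IsSiegelModularForm E7.SpZ k (E7.restrict F)) ∧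
    (E7.IsCuspForm k F → E7.IsSiegelCuspForm k (E7.restrict F)) := by
  refine ⟨fun Γ hΓ hF => ⟨_, E7.commensurable_map_fst hΓ, hF.restrict ?_⟩,
    fun hF => hF.restrict_levelOne, fun hF => ⟨hF.modular.restrict_levelOne, fun Z hZ => ?_⟩⟩
  · rintro _ ⟨p, ⟨⟨hp, -⟩, hp'⟩, rfl⟩
    exact ⟨p.2, hp', hp⟩
  · have h := hF.cusp _ (E7.mem_exceptionalDomain₂ hZ)
    simpa only [E7.restrict, E7.ofSymm_siegelBlock] using h
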